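/- Let $L$ and $M$ be algebraically closed subfields of a common field, neither contained in the other, and assume that $L$ and $M$ are linearly disjoint over their intersection $C := L\cap M$. Let $N := LM$ be their compositum, let $N^{\mathrm{ab}}$ be the maximal abelian extension of $N$ (the compositum of all abelian Galois extensions of $N$ inside an algebraic closure of $N$), and let $G_N^{\mathrm{ab}} := \mathrm{Gal}(N^{\mathrm{ab}}/N)$ with its Krull topology. Then $G_N^{\mathrm{ab}}$ is the free pro-abelian group of rank $|N|$. That is, there is a family $(g_x)_{x\in N}$ in the pro-abelian (commutative profinite) group $G_N^{\mathrm{ab}}$ converging to $1$ (every neighbourhood of $1$ contains $g_x$ for all but finitely many $x$) such that every family $(a_x)_{x\in N}$ converging to $1$ in a pro-abelian group $A$ is of the form $a_x=\varphi(g_x)$ for a unique continuous homomorphism $\varphi : G_N^{\mathrm{ab}}\to A$. Equivalently, there is an isomorphism of topological groups $$G_N^{\mathrm{ab}}\;\cong\;\widehat{\mathbb Z}^{\,N}=\prod_{x\in N}\widehat{\mathbb Z},\qquad \widehat{\mathbb Z}=\varprojlim_n \mathbb Z/n\mathbb Z .$$ In particular, $N$ is not separably closed. -/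

import Mathlib

universe w u v

/-- The maximal abelian extension of a field `F`: the compositum, inside an algebraic closure
of `F`, of all abelian Galois extensions of `F`. -/
noncomputable def maximalAbelianExtension (F : Type*) [Field F] :
    IntermediateField F (AlgebraicClosure F) :=
  ⨆ (K : IntermediateField F (AlgebraicClosure F)) (_ : IsAbelianGalois F K), K

/-- The Galois group of the maximal abelian extension of `F`, a topological group for the Krull
topology. -/
abbrev maximalAbelianGaloisGroup (F : Type*) [Field F] : Type _ :=
  Gal(maximalAbelianExtension F/F)

/-- The additive group `Ẑ = lim ℤ/nℤ` of profinite integers: compatible families of residue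
classes, as a subgroup of the product of the groups `ℤ/nℤ`, `n ≥ 1`. It carries the subspace
topology of the product topology of the discrete groups `ℤ/nℤ`. -/
def ProfiniteInt : AddSubgroup (∀ n : ℕ+, ZMod (n : ℕ)) where
  carrier := {x | ∀ (m n : ℕ+) (h : (m : ℕ) ∣ (n : ℕ)), ZMod.castHom h (ZMod (m : ℕ)) (x n) = x m}
  zero_mem' := fun m n h => by simp
  add_mem' := fun {x y} hx hy m n h => by
    rw [Pi.add_apply, Pi.add_apply, map_add, hx m n h, hy m n h]
  neg_mem' := fun {x} hx m n h => by
    rw [Pi.neg_apply, Pi.neg_apply, map_neg, hx m n h]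

/-- A pro-abelian group: a commutative profinite group (equivalently, an inverse limit of finite
abelian groups). -/
structure IsProAbelian (G : Type*) [Group G] [TopologicalSpace G] : Prop where
  isTopologicalGroup : IsTopologicalGroup G
  compactSpace : CompactSpace G
  t2Space : T2Space G
  totallyDisconnectedSpace : TotallyDisconnectedSpace G
  mul_comm : ∀ a b : G, a * b = b * a

/-- `G` is the free pro-abelian group on the family `ι : X → G`, in the usual sense of free
pro-`𝒞` groups: the family `ι` converges to `1`, and every family `f : X → A` converging to `1`
in a pro-abelian group `A` extends uniquely to a continuous homomorphism `G → A`. The rank of `G`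
is then the cardinality of `X`. -/
structure IsFreeProAbelianOn {X : Type u} {G : Type v} [Group G] [TopologicalSpace G]
    (ι : X → G) : Prop where
  isProAbelian : IsProAbelian G
  tendsto : Filter.Tendsto ι Filter.cofinite (nhds 1)
  existsUnique_lift : ∀ (A : Type w) [Group A] [TopologicalSpace A], IsProAbelian A →
    ∀ f : X → A, Filter.Tendsto f Filter.cofinite (nhds 1) →
      ∃! φ : G →ₜ* A, ∀ x, φ (ι x) = f x

/-!
The group `G = Gal(N^ab/N)` is determined by its group of characters with values in `ℚ/ℤ`, which is
also the group of characters of the absolute Galois group of `N`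
(`nonempty_characterGroup_maximalAbelian`). By duality, `G` is `Ẑ^N`, and hence free, once this
character group is a direct sum of `#N` copies of `ℚ/ℤ` (`nonempty_continuousMulEquiv_profiniteInt`,
`isFreeProAbelianOn_profiniteBasis`). It is a torsion group, so that it suffices that it is
divisible and that its `ℓ`-torsion has dimension `#N` over `𝔽_ℓ` for every prime `ℓ`
(`nonempty_addEquiv_finsupp`).

Divisibility holds because `N` contains all roots of unity, so that one can extract roots of Kummer
generators (`exists_nsmul_eq_of_isPrimitiveRoot`). At the characteristic it is the theorem of Albert
and Witt that cyclic `p`-extensions embed into larger ones (`exists_nsmul_eq_of_charP`). The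
dimensions are at most `#N`, by counting generators. For the lower bound, Kummer and Artin–Schreier
theory ask for `#N` elements of `N` that are independent modulo `ℓ`-th powers, and whose inverses
are independent modulo `x ^ p - x`.

These elements are `t + m` with a fixed `t ∈ L` outside `M`, where `m` runs through the elements of
`M` outside `L`; by symmetry `#L ≤ #M` may be assumed, and then there are `#N` of them. For every
`m₀` among the `m` there is a valuation of `N` at which `t + m₀` is a uniformizer and every other
`t + m` is a unit; the independence follows by looking at orders of zeros and poles
(`HasUniformizingEmbeddings`). To get the valuation, choose a transcendence basis of `L` over `C`
that contains `t`, and let `T` be the set of its other members. By linear disjointness `t` is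
transcendental over `B = M(T)`, so `B(t)` embeds into Laurent series over the algebraic closure of
`B` by `t ↦ X - m₀`. This substitution has no zero or pole on `C(T)(t)`, because `m₀` is
transcendental over `C(T)`, again by linear disjointness. As `L` is algebraic over `C(T)(t)`,
Hensel's lemma extends the embedding to the compositum of `L` and `B`, up to purely inseparable
elements (`exists_laurentSeries_embedding`). Those are harmless: `p`-power exponents are prime to
`ℓ ≠ p` and do not change classes modulo `x ^ p - x`.
-/

/-! ### Divisible torsion groups -/

/-- The group `ℚ/ℤ`, in which all characters take their values. -/
abbrev RatModInt : Type := AddCircle (1 : ℚ)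

namespace RatModInt

theorem exists_nsmul_eq_zero (q : RatModInt) : ∃ n : ℕ, 0 < n ∧ n • q = 0 := by
  obtain ⟨r, rfl⟩ := QuotientAddGroup.mk_surjective q
  refine ⟨r.den, r.den_pos, ?_⟩
  change ((r.den • r : ℚ) : AddCircle (1 : ℚ)) = 0
  rw [AddCircle.coe_eq_zero_iff]
  exact ⟨r.num, by simp [mul_comm]⟩

/-- The class of `1 / n` in `ℚ/ℤ`, an element of order `n`. -/
noncomputable def inv (n : ℕ) : RatModInt := ((1 / n : ℚ) : AddCircle (1 : ℚ))

theorem nsmul_inv_self (n : ℕ) : n • inv n = 0 := by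
  rcases Nat.eq_zero_or_pos n with rfl | hn
  · simp
  · rw [inv, ← AddCircle.addOrderOf_period_div (p := (1 : ℚ)) hn,
      AddCircle.addOrderOf_period_div hn]
    have := addOrderOf_nsmul_eq_zero (((1 : ℚ) / n : ℚ) : AddCircle (1 : ℚ))
    rwa [AddCircle.addOrderOf_period_div hn] at this

theorem addOrderOf_inv {n : ℕ} (hn : 0 < n) : addOrderOf (inv n) = n :=
  AddCircle.addOrderOf_period_div hn

theorem nsmul_inv_mul (m : ℕ) {k : ℕ} (hk : 0 < k) : k • inv (m * k) = inv m := by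
  rw [inv, inv]
  change ((k • (1 / (m * k : ℕ) : ℚ) : ℚ) : AddCircle (1 : ℚ)) = _
  congr 1
  have : (k : ℚ) ≠ 0 := by positivity
  rcases Nat.eq_zero_or_pos m with rfl | hm
  · simp
  · have : (m : ℚ) ≠ 0 := by positivity
    push_cast
    rw [nsmul_eq_mul]
    field_simp

/-- The homomorphism `ℤ/n → ℚ/ℤ`, `k ↦ k / n`. -/
noncomputable def ofZMod (n : ℕ) : ZMod n →+ RatModInt :=
  ZMod.lift n ⟨zmultiplesHom _ (inv n), by simpa using nsmul_inv_self n⟩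

@[simp] theorem ofZMod_intCast (n : ℕ) (k : ℤ) : ofZMod n (k : ZMod n) = k • inv n := by
  simp [ofZMod]

theorem ofZMod_injective {n : ℕ} (hn : 0 < n) : Function.Injective (ofZMod n) := by
  rw [injective_iff_map_eq_zero]
  intro a ha
  obtain ⟨k, rfl⟩ := ZMod.intCast_surjective a
  rw [ofZMod_intCast, ← addOrderOf_dvd_iff_zsmul_eq_zero, addOrderOf_inv hn] at ha
  exact (ZMod.intCast_zmod_eq_zero_iff_dvd k n).2 ha

theorem exists_ofZMod_eq {n : ℕ} (hn : 0 < n) {q : RatModInt} (hq : n • q = 0) :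
    ∃ a : ZMod n, ofZMod n a = q := by
  obtain ⟨r, rfl⟩ := QuotientAddGroup.mk_surjective q
  change ((n • r : ℚ) : AddCircle (1 : ℚ)) = 0 at hq
  rw [AddCircle.coe_eq_zero_iff] at hq
  obtain ⟨k, hk⟩ := hq
  refine ⟨k, ?_⟩
  rw [ofZMod_intCast, inv]
  change ((k • (1 / n : ℚ) : ℚ) : AddCircle (1 : ℚ)) = (r : AddCircle (1 : ℚ))
  congr 1
  have : (n : ℚ) ≠ 0 := by positivity
  simp only [zsmul_eq_mul, mul_one, nsmul_eq_mul] at hk ⊢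
  rw [hk]
  field_simp

theorem nsmul_ofZMod (n : ℕ) (a : ZMod n) : n • ofZMod n a = 0 := by
  rw [← map_nsmul]; simp

end RatModInt

/-- A family in an abelian group is independent modulo `ℓ` if all coefficients of a vanishing
integral combination are divisible by `ℓ`. For a family of elements killed by a prime `ℓ` this is
linear independence over `𝔽_ℓ`. -/
def IsIndepMod {A S : Type*} [AddCommGroup A] (ℓ : ℕ) (f : S → A) : Prop :=
  ∀ (F : Finset S) (c : S → ℤ), ∑ s ∈ F, c s • f s = 0 → ∀ s ∈ F, (ℓ : ℤ) ∣ c s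

open Cardinal in
/-- If the `ℓ`-torsion of `A` and of `B` has cardinality at most `#S` and contains an independent
family indexed by the infinite set `S`, then both are `𝔽_ℓ`-vector spaces of dimension `#S`. -/
theorem nonempty_torsionBy_equiv {A B S : Type u} [AddCommGroup A] [AddCommGroup B] [Infinite S]
    {ℓ : ℕ} (hℓ : ℓ.Prime) {f : S → A} {g : S → B}
    (hf : ∀ s, (ℓ : ℤ) • f s = 0) (hg : ∀ s, (ℓ : ℤ) • g s = 0)
    (hfi : IsIndepMod ℓ f) (hgi : IsIndepMod ℓ g)
    (hA : #(Submodule.torsionBy ℤ A ℓ) ≤ #S) (hB : #(Submodule.torsionBy ℤ B ℓ) ≤ #S) :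
    Nonempty (Submodule.torsionBy ℤ A ℓ ≃+ Submodule.torsionBy ℤ B ℓ) := by
  have : Fact ℓ.Prime := ⟨hℓ⟩
  have key : ∀ (D : Type u) [AddCommGroup D] [Module (ZMod ℓ) (Submodule.torsionBy ℤ D ℓ)]
      (f : S → D), (∀ s, (ℓ : ℤ) • f s = 0) → IsIndepMod ℓ f →
      #(Submodule.torsionBy ℤ D ℓ) ≤ #S →
      Nonempty (Module.Basis S (ZMod ℓ) (Submodule.torsionBy ℤ D ℓ)) := by
    intro D _ _ f hf hfi hD
    let b := Module.Basis.ofVectorSpace (ZMod ℓ) (Submodule.torsionBy ℤ D ℓ)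
    suffices h : Module.rank (ZMod ℓ) (Submodule.torsionBy ℤ D ℓ) = #S by
      rw [← b.mk_eq_rank''] at h
      exact (Cardinal.eq.1 h).map b.reindex
    refine le_antisymm ((rank_le_card _ _).trans hD) ?_
    have hli : LinearIndependent (ZMod ℓ)
        (fun s => (⟨f s, by simpa using hf s⟩ : Submodule.torsionBy ℤ D ℓ)) := by
      rw [linearIndependent_iff']
      intro F c hc s hs
      choose z hz using fun s => ZMod.intCast_surjective (c s)
      rw [← hz, ZMod.intCast_zmod_eq_zero_iff_dvd]
      refine hfi F z ?_ s hs
      have := congrArg Subtype.val hc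
      simp only [← hz, Int.cast_smul_eq_zsmul] at this
      simpa using this
    exact hli.cardinal_le_rank
  let mA : Module (ZMod ℓ) (Submodule.torsionBy ℤ A ℓ) :=
    AddCommGroup.zmodModule fun x => by
      ext; exact (natCast_zsmul (x : A) ℓ).symm.trans x.2
  let mB : Module (ZMod ℓ) (Submodule.torsionBy ℤ B ℓ) :=
    AddCommGroup.zmodModule fun x => by
      ext; exact (natCast_zsmul (x : B) ℓ).symm.trans x.2
  obtain ⟨bA⟩ := key A f hf hfi hA
  obtain ⟨bB⟩ := key B g hg hgi hB
  exact ⟨(bA.equiv bB (Equiv.refl S)).toAddEquiv⟩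

/-- Two divisible torsion groups with isomorphic `ℓ`-torsion for every prime `ℓ` are isomorphic:
an isomorphism of the socles extends, since divisible groups are injective. -/
theorem nonempty_addEquiv_of_torsionBy {A B : Type u} [AddCommGroup A] [AddCommGroup B]
    (tA : ∀ a : A, ∃ n : ℕ, 0 < n ∧ n • a = 0) (tB : ∀ b : B, ∃ n : ℕ, 0 < n ∧ n • b = 0)
    (dA : ∀ (n : ℕ), 0 < n → ∀ a : A, ∃ b, n • b = a)
    (dB : ∀ (n : ℕ), 0 < n → ∀ a : B, ∃ b, n • b = a)
    (h : ∀ ℓ : ℕ, ℓ.Prime →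
      Nonempty (Submodule.torsionBy ℤ A ℓ ≃+ Submodule.torsionBy ℤ B ℓ)) :
    Nonempty (A ≃+ B) := by
  classical
  have e := fun ℓ : Nat.Primes => (h ℓ ℓ.2).some
  let p : Nat.Primes → Submodule ℤ A := fun ℓ => Submodule.torsionBy ℤ A (ℓ : ℤ)
  have hind : iSupIndep p := by
    rw [iSupIndep_iff_supIndep]
    intro S
    refine Submodule.supIndep_torsionBy (R := ℤ) (M := A) (q := fun ℓ : Nat.Primes => (ℓ : ℤ)) ?_
    intro a _ b _ hab
    exact Nat.isCoprime_iff_coprime.2 ((Nat.coprime_primes a.2 b.2).2 fun h => hab (Subtype.ext h))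
  -- the direct sum of the `A[ℓ]` is a subgroup of `A`, and the sum of the isomorphisms
  -- `A[ℓ] ≃ B[ℓ]` extends from it to `A` because `B` is injective
  have hinj := hind.dfinsupp_lsum_injective
  have : DivisibleBy B ℤ := AddCommGroup.divisibleByIntOfSMulTopEqTop B (by
    intro n hn
    rw [eq_top_iff]
    intro b _
    obtain ⟨c, hc⟩ := dB n.natAbs (Int.natAbs_pos.2 hn) b
    rcases Int.natAbs_eq n with h | h
    · refine ⟨c, trivial, ?_⟩
      change n • c = b
      rw [← hc, ← natCast_zsmul, ← h]
    · refine ⟨-c, trivial, ?_⟩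
      change n • (-c) = b
      rw [← hc, ← natCast_zsmul, smul_neg, ← neg_smul]
      congr 1
      omega)
  obtain ⟨φ, hφ⟩ := (Module.Baer.of_divisible B).extension_property _ hinj
    (DFinsupp.lsum ℕ fun ℓ : Nat.Primes =>
      (Submodule.torsionBy ℤ B (ℓ : ℤ)).subtype.comp (e ℓ).toIntLinearEquiv.toLinearMap)
  have hφe : ∀ (ℓ : Nat.Primes) (x : p ℓ), φ x = e ℓ x := by
    intro ℓ x
    have := LinearMap.congr_fun hφ (DFinsupp.single ℓ x)
    simpa using this
  -- a nonzero element of the kernel would have a multiple of prime order in the kernel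
  have hφinj : Function.Injective φ := by
    rw [injective_iff_map_eq_zero]
    intro a ha
    obtain ⟨n, hn, hna⟩ := tA a
    by_contra ha0
    have hord : addOrderOf a ≠ 1 := by simpa using ha0
    obtain ⟨ℓ, hℓ, k, hk⟩ := Nat.exists_prime_and_dvd hord
    have hpos : 0 < addOrderOf a := addOrderOf_pos_iff.2
      (isOfFinAddOrder_iff_nsmul_eq_zero.2 ⟨n, hn, hna⟩)
    have hka : k • a ≠ 0 := by
      intro h0
      have := Nat.le_of_dvd (by rcases Nat.eq_zero_or_pos k with rfl | h <;> simp_all)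
        (addOrderOf_dvd_of_nsmul_eq_zero h0)
      have h2 := hℓ.two_le
      nlinarith
    have hmem : k • a ∈ p ⟨ℓ, hℓ⟩ := by
      change (ℓ : ℤ) • k • a = 0
      rw [natCast_zsmul, smul_smul, ← hk, addOrderOf_nsmul_eq_zero]
    have h0 : φ (k • a) = 0 := by rw [map_nsmul, ha, smul_zero]
    rw [hφe ⟨ℓ, hℓ⟩ ⟨k • a, hmem⟩] at h0
    have := (e ⟨ℓ, hℓ⟩).map_eq_zero_iff.1 (Subtype.ext h0 : e ⟨ℓ, hℓ⟩ ⟨k • a, hmem⟩ = 0)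
    exact hka (congrArg Subtype.val this)
  have hφsurj : ∀ n : ℕ, 0 < n → ∀ b : B, n • b = 0 → ∃ a, φ a = b := by
    intro n
    induction n using Nat.strong_induction_on with
    | _ n ih =>
      intro hn b hb
      rcases eq_or_ne n 1 with rfl | hn1
      · exact ⟨0, by simpa using hb.symm⟩
      obtain ⟨ℓ, hℓ, k, rfl⟩ := Nat.exists_prime_and_dvd hn1
      have hk : 0 < k := Nat.pos_of_mul_pos_left hn
      have hmem : k • b ∈ Submodule.torsionBy ℤ B (ℓ : ℤ) := by
        change (ℓ : ℤ) • k • b = 0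
        rw [natCast_zsmul, smul_smul, hb]
      obtain ⟨a, ha⟩ := (e ⟨ℓ, hℓ⟩).surjective ⟨k • b, hmem⟩
      have ha' : φ a = k • b := by rw [hφe ⟨ℓ, hℓ⟩ a, ha]
      obtain ⟨a', ha''⟩ := dA k hk a
      obtain ⟨c, hc⟩ := ih k (by nlinarith [hℓ.two_le]) hk (b - φ a') (by
        rw [smul_sub, ← map_nsmul, ha'', ha', sub_self])
      exact ⟨c + a', by rw [map_add, hc]; abel⟩
  exact ⟨AddEquiv.ofBijective φ.toAddMonoidHom ⟨hφinj, fun b => by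
    obtain ⟨n, hn, hb⟩ := tB b
    exact hφsurj n hn b hb⟩⟩

open Cardinal in
/-- A divisible torsion group whose `ℓ`-torsion has rank `#S` for every prime `ℓ` is a direct sum
of `#S` copies of `ℚ/ℤ`. -/
theorem nonempty_addEquiv_finsupp {A S : Type u} [AddCommGroup A] [Infinite S]
    (tA : ∀ a : A, ∃ n : ℕ, 0 < n ∧ n • a = 0)
    (dA : ∀ (n : ℕ), 0 < n → ∀ a : A, ∃ b, n • b = a)
    (cA : ∀ ℓ : ℕ, ℓ.Prime → #(Submodule.torsionBy ℤ A ℓ) ≤ #S)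
    (iA : ∀ ℓ : ℕ, ℓ.Prime → ∃ f : S → A, (∀ s, (ℓ : ℤ) • f s = 0) ∧ IsIndepMod ℓ f) :
    Nonempty (A ≃+ (S →₀ RatModInt)) := by
  classical
  refine nonempty_addEquiv_of_torsionBy tA ?_ dA ?_ fun ℓ hℓ => ?_
  · intro b
    induction b using Finsupp.induction_linear with
    | zero => exact ⟨1, one_pos, by simp⟩
    | add x y hx hy =>
      obtain ⟨n, hn, hx⟩ := hx
      obtain ⟨m, hm, hy⟩ := hy
      exact ⟨n * m, by positivity, by
        rw [smul_add, mul_smul n m y, hy, mul_comm, mul_smul, hx, smul_zero, smul_zero, add_zero]⟩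
    | single s q =>
      obtain ⟨n, hn, hq⟩ := RatModInt.exists_nsmul_eq_zero q
      exact ⟨n, hn, by rw [Finsupp.smul_single, hq, Finsupp.single_zero]⟩
  · intro n hn b
    induction b using Finsupp.induction_linear with
    | zero => exact ⟨0, by simp⟩
    | add x y hx hy =>
      obtain ⟨x, rfl⟩ := hx
      obtain ⟨y, rfl⟩ := hy
      exact ⟨x + y, smul_add _ _ _⟩
    | single s q =>
      refine ⟨Finsupp.single s (DivisibleBy.div q (n : ℤ)), ?_⟩
      rw [Finsupp.smul_single, ← natCast_zsmul, DivisibleBy.div_cancel]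
      exact_mod_cast hn.ne'
  · obtain ⟨f, hf, hfi⟩ := iA ℓ hℓ
    refine nonempty_torsionBy_equiv hℓ hf (g := fun s => Finsupp.single s (RatModInt.inv ℓ)) ?_ hfi
      ?_ (cA ℓ hℓ) ?_
    · intro s
      rw [Finsupp.smul_single, natCast_zsmul, RatModInt.nsmul_inv_self, Finsupp.single_zero]
    · intro F c hc s hs
      have := DFunLike.congr_fun hc s
      simp only [Finsupp.finsetSum_apply, Finsupp.smul_apply, Finsupp.single_apply, smul_ite,
        smul_zero, Finset.sum_ite_eq', hs, if_true, Finsupp.coe_zero, Pi.zero_apply] at this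
      rwa [← addOrderOf_dvd_iff_zsmul_eq_zero, RatModInt.addOrderOf_inv hℓ.pos] at this
    · refine (mk_subtype_le _).trans ?_
      have : Nontrivial RatModInt := ⟨RatModInt.inv 2, 0, fun h => by
        simpa [h] using RatModInt.addOrderOf_inv two_pos⟩
      have : Countable RatModInt := QuotientAddGroup.mk_surjective.countable
      rw [mk_finsupp_lift_of_infinite]
      refine max_le (by simp) ?_
      exact (lift_le_aleph0.2 (mk_le_aleph0 (α := RatModInt))).trans (aleph0_le_mk S)

/-! ### Characters and Pontryagin duality -/

/-- The character group of a topological group `G`: locally constant homomorphisms from `G` to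
`ℚ/ℤ`, realised inside the group of all functions `G → ℚ/ℤ`. -/
def characterGroup (G : Type*) [Group G] [TopologicalSpace G] : AddSubgroup (G → RatModInt) where
  carrier := {χ | IsLocallyConstant χ ∧ ∀ g h, χ (g * h) = χ g + χ h}
  zero_mem' := ⟨IsLocallyConstant.const 0, fun _ _ => by simp⟩
  add_mem' := fun {χ ψ} hχ hψ => ⟨hχ.1.add hψ.1, fun g h => by
    simp only [Pi.add_apply, hχ.2, hψ.2]; abel⟩
  neg_mem' := fun {χ} hχ => ⟨hχ.1.neg, fun g h => by
    simp only [Pi.neg_apply, hχ.2]; abel⟩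

namespace characterGroup

variable {G : Type*} [Group G] [TopologicalSpace G]

theorem map_mul (χ : characterGroup G) (g h : G) : χ.1 (g * h) = χ.1 g + χ.1 h := χ.2.2 g h

theorem map_one (χ : characterGroup G) : χ.1 1 = 0 := by
  have := map_mul χ 1 1
  rwa [mul_one, left_eq_add] at this

theorem exists_nsmul_eq_zero [CompactSpace G] (χ : characterGroup G) :
    ∃ n : ℕ, 0 < n ∧ n • χ = 0 := by
  choose N hN hN0 using RatModInt.exists_nsmul_eq_zero
  refine ⟨∏ q ∈ χ.2.1.range_finite.toFinset, N q, Finset.prod_pos fun q _ => hN q, ?_⟩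
  ext g
  have hg : χ.1 g ∈ χ.2.1.range_finite.toFinset := by simp
  obtain ⟨k, hk⟩ := Finset.dvd_prod_of_mem N hg
  rw [hk, mul_comm, mul_smul]
  change k • N (χ.1 g) • χ.1 g = 0
  rw [hN0, smul_zero]

/-- Characters of a commutative profinite group separate points. -/
theorem exists_ne_zero [IsTopologicalGroup G] [CompactSpace G] [T2Space G]
    [TotallyDisconnectedSpace G] (hcomm : ∀ a b : G, a * b = b * a) {g : G} (hg : g ≠ 1) :
    ∃ χ : characterGroup G, χ.1 g ≠ 0 := by
  let _ : CommGroup G := { (inferInstance : Group G) with mul_comm := hcomm }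
  obtain ⟨U, hU⟩ := ProfiniteGrp.exist_openNormalSubgroup_sub_open_nhds_of_one
    (isOpen_compl_singleton (x := g)) (show (1 : G) ∈ ({g}ᶜ : Set G) by simpa using hg.symm)
  have hgU : g ∉ U.toSubgroup := fun h => hU h rfl
  have hne : Additive.ofMul (g : G ⧸ U.toSubgroup) ≠ 0 := by
    intro h
    exact hgU ((QuotientGroup.eq_one_iff g).1 h)
  obtain ⟨c, hc⟩ := CharacterModule.exists_character_apply_ne_zero_of_ne_zero hne
  refine ⟨⟨fun x => c (Additive.ofMul (x : G ⧸ U.toSubgroup)), ?_, fun x y => ?_⟩, hc⟩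
  · have : DiscreteTopology (G ⧸ U.toSubgroup) := QuotientGroup.discreteTopology U.isOpen'
    exact ((IsLocallyConstant.of_discrete (fun y : G ⧸ U.toSubgroup => y)).comp_continuous
      QuotientGroup.continuous_mk).comp fun y => c (Additive.ofMul y)
  · exact _root_.map_add c (Additive.ofMul (x : G ⧸ U.toSubgroup)) (Additive.ofMul (y : _))

end characterGroup

/-- The embeddings of `ℤ/m` and `ℤ/n` into `ℚ/ℤ` turn reduction modulo `m` into multiplication by
`n / m`. -/
theorem RatModInt.ofZMod_castHom {m n : ℕ} (hn : 0 < n) (h : m ∣ n) (a : ZMod n) :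
    ofZMod m (ZMod.castHom h (ZMod m) a) = (n / m) • ofZMod n a := by
  obtain ⟨k, rfl⟩ := ZMod.intCast_surjective a
  obtain ⟨d, rfl⟩ := h
  have hm : 0 < m := Nat.pos_of_mul_pos_right hn
  have hd : 0 < d := Nat.pos_of_mul_pos_left hn
  rw [map_intCast, ofZMod_intCast, ofZMod_intCast, Nat.mul_div_cancel_left _ hm, smul_comm,
    nsmul_inv_mul m hd]

section Dual

variable {G : Type u} [Group G] [TopologicalSpace G] {I : Type v}
  (e : characterGroup G ≃+ (I →₀ RatModInt))

/-- The character of `G` corresponding to `1 / n` in the `i`-th copy of `ℚ/ℤ`. -/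
noncomputable def basicCharacter (i : I) (n : ℕ) : characterGroup G :=
  e.symm (Finsupp.single i (RatModInt.inv n))

theorem nsmul_basicCharacter (i : I) (n : ℕ) : n • basicCharacter e i n = 0 := by
  rw [basicCharacter, ← map_nsmul, Finsupp.smul_single, RatModInt.nsmul_inv_self]
  simp

theorem basicCharacter_of_dvd (i : I) {m n : ℕ} (hn : 0 < n) (h : m ∣ n) :
    basicCharacter e i m = (n / m) • basicCharacter e i n := by
  obtain ⟨d, rfl⟩ := h
  rw [basicCharacter, basicCharacter, ← map_nsmul, Finsupp.smul_single,
    Nat.mul_div_cancel_left _ (Nat.pos_of_mul_pos_right hn),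
    RatModInt.nsmul_inv_mul m (Nat.pos_of_mul_pos_left hn)]

theorem exists_ofZMod_eq_basicCharacter (i : I) {n : ℕ} (hn : 0 < n) (g : G) :
    ∃ a : ZMod n, RatModInt.ofZMod n a = (basicCharacter e i n).1 g :=
  RatModInt.exists_ofZMod_eq hn (congrFun (congrArg Subtype.val (nsmul_basicCharacter e i n)) g)

/-- The values of `basicCharacter e i n`, read in `ℤ/n`. -/
noncomputable def basicCoord (i : I) (n : ℕ) (g : G) : ZMod n :=
  Function.invFun (RatModInt.ofZMod n) ((basicCharacter e i n).1 g)

theorem ofZMod_basicCoord (i : I) {n : ℕ} (hn : 0 < n) (g : G) :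
    RatModInt.ofZMod n (basicCoord e i n g) = (basicCharacter e i n).1 g :=
  Function.invFun_eq (exists_ofZMod_eq_basicCharacter e i hn g)

theorem isLocallyConstant_basicCoord (i : I) (n : ℕ) :
    IsLocallyConstant (basicCoord e i n) :=
  (basicCharacter e i n).2.1.comp (Function.invFun (RatModInt.ofZMod n))

theorem basicCoord_mul (i : I) {n : ℕ} (hn : 0 < n) (g h : G) :
    basicCoord e i n (g * h) = basicCoord e i n g + basicCoord e i n h := by
  apply RatModInt.ofZMod_injective hn
  simp only [map_add, ofZMod_basicCoord e i hn, characterGroup.map_mul]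

theorem castHom_basicCoord (i : I) {m n : ℕ} (hm : 0 < m) (hn : 0 < n) (h : m ∣ n) (g : G) :
    ZMod.castHom h (ZMod m) (basicCoord e i n g) = basicCoord e i m g := by
  apply RatModInt.ofZMod_injective hm
  rw [RatModInt.ofZMod_castHom hn h, ofZMod_basicCoord e i hn, ofZMod_basicCoord e i hm,
    basicCharacter_of_dvd e i hn h]
  rfl

/-- Finitely many coordinates modulo `n` can be prescribed arbitrarily: otherwise a nontrivial
character of `(ℤ/n)^F` would vanish on the image of `G`, which is a relation between the basic
characters. -/
theorem exists_basicCoord_eq {n : ℕ} (hn : 0 < n) (F : Finset I) (a : I → ZMod n) :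
    ∃ g : G, ∀ i ∈ F, basicCoord e i n g = a i := by
  classical
  let φ : Additive G →+ (F → ZMod n) :=
    { toFun := fun g i => basicCoord e i n g.toMul
      map_zero' := by
        funext i
        have := basicCoord_mul e i hn 1 1
        rw [mul_one, left_eq_add] at this
        exact this
      map_add' := fun g h => funext fun i => basicCoord_mul e i hn _ _ }
  suffices h : φ.range = ⊤ by
    obtain ⟨g, hg⟩ := AddMonoidHom.range_eq_top.1 h fun i => a i
    exact ⟨g.toMul, fun i hi => congrFun hg ⟨i, hi⟩⟩
  by_contra h
  obtain ⟨v, -, hv⟩ := SetLike.exists_of_lt (lt_top_iff_ne_top.2 h)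
  have hne : (QuotientAddGroup.mk v : (F → ZMod n) ⧸ φ.range) ≠ 0 := fun h0 =>
    hv ((QuotientAddGroup.eq_zero_iff v).1 h0)
  obtain ⟨c, hc⟩ := CharacterModule.exists_character_apply_ne_zero_of_ne_zero hne
  let l : (F → ZMod n) →+ RatModInt :=
    (show _ →+ RatModInt from c).comp (QuotientAddGroup.mk' φ.range)
  have hl : ∀ g, l (φ g) = 0 := fun g => by
    have : QuotientAddGroup.mk' φ.range (φ g) = 0 := (QuotientAddGroup.eq_zero_iff _).2 ⟨g, rfl⟩
    exact (congrArg c this).trans (map_zero c)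
  have hlv : l v ≠ 0 := hc
  have hk : ∀ i : F, ∃ k : ℤ, k • RatModInt.inv n = l (Pi.single i 1) := by
    intro i
    obtain ⟨b, hb⟩ := RatModInt.exists_ofZMod_eq hn (q := l (Pi.single i 1)) (by
      rw [← map_nsmul, ← Pi.single_smul']; simp)
    obtain ⟨k, rfl⟩ := ZMod.intCast_surjective b
    exact ⟨k, by rw [← hb, RatModInt.ofZMod_intCast]⟩
  choose k hk using hk
  have hlw : ∀ w : F → ZMod n, l w = ∑ i, k i • RatModInt.ofZMod n (w i) := by
    intro w
    conv_lhs => rw [← Finset.univ_sum_single w]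
    rw [map_sum]
    refine Finset.sum_congr rfl fun i _ => ?_
    obtain ⟨z, hz⟩ := ZMod.intCast_surjective (w i)
    rw [← hz, RatModInt.ofZMod_intCast, smul_comm, hk, ← map_zsmul, ← Pi.single_smul']
    simp
  have hrel : ∑ i : F, k i • basicCharacter e i n = 0 := by
    ext g
    have := hl (Additive.ofMul g)
    rw [hlw] at this
    rw [AddSubgroup.val_finsetSum, Finset.sum_apply]
    rw [show ((0 : characterGroup G) : G → RatModInt) g = 0 from rfl, ← this]
    exact Finset.sum_congr rfl fun i _ => by
      rw [show φ (Additive.ofMul g) i = basicCoord e i n g from rfl, ofZMod_basicCoord e i hn]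
      rfl
  have hz : ∀ i : F, k i • RatModInt.inv n = 0 := by
    intro i
    have h1 := congrArg e hrel
    simp only [map_sum, map_zsmul, basicCharacter, AddEquiv.apply_symm_apply, map_zero] at h1
    have h2 := DFunLike.congr_fun h1 (i : I)
    simpa [Finsupp.finsetSum_apply, Finsupp.single_apply, Subtype.val_inj] using h2
  refine hlv ?_
  rw [hlw]
  refine Finset.sum_eq_zero fun i _ => ?_
  obtain ⟨z, hz'⟩ := ZMod.intCast_surjective (v i)
  rw [← hz', RatModInt.ofZMod_intCast, smul_comm, hz, smul_zero]

/-- The homomorphism `G → Ẑ^I` whose coordinates are the basic characters. -/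
noncomputable def toProfiniteInt : G →* Multiplicative (I → ProfiniteInt) :=
  MonoidHom.mk' (fun g => Multiplicative.ofAdd fun i =>
    ⟨fun n => basicCoord e i n g, fun m n h => castHom_basicCoord e i m.pos n.pos h g⟩)
    fun g h => by
      rw [← ofAdd_add]
      congr 1
      funext i
      ext n
      exact basicCoord_mul e i n.pos g h

theorem toProfiniteInt_apply (g : G) (i : I) (n : ℕ+) :
    ((toProfiniteInt e g).toAdd i).1 n = basicCoord e i n g := rfl

theorem continuous_toProfiniteInt : Continuous (toProfiniteInt e) := by
  refine continuous_ofAdd.comp (continuous_pi fun i => Continuous.subtype_mk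
    (continuous_pi fun n : ℕ+ => (isLocallyConstant_basicCoord e i n).continuous) _)

/-- Any finite number of congruences on the coordinates can be solved in `G`, hence all of them, by
compactness. -/
theorem toProfiniteInt_surjective [CompactSpace G] : Function.Surjective (toProfiniteInt e) := by
  classical
  intro z
  have hclosed : ∀ p : I × ℕ+, IsClosed {g | basicCoord e p.1 p.2 g = (z.toAdd p.1).1 p.2} :=
    fun p => (isLocallyConstant_basicCoord e p.1 p.2).isClosed_fiber _
  obtain ⟨g, hg⟩ := CompactSpace.iInter_nonempty hclosed fun F => by
    let n : ℕ+ := ∏ p ∈ F, p.2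
    obtain ⟨g, hg⟩ := exists_basicCoord_eq e n.pos (F.image Prod.fst) fun i => (z.toAdd i).1 n
    refine ⟨g, Set.mem_iInter₂.2 fun p hp => ?_⟩
    have hdvd : (p.2 : ℕ) ∣ n := PNat.dvd_iff.1 (Finset.dvd_prod_of_mem Prod.snd hp)
    have := hg p.1 (Finset.mem_image_of_mem _ hp)
    rw [Set.mem_ofPred_eq, ← castHom_basicCoord e p.1 p.2.pos n.pos hdvd, this]
    exact (z.toAdd p.1).2 _ _ hdvd
  refine ⟨g, ?_⟩
  apply Multiplicative.toAdd.injective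
  funext i
  ext n
  exact Set.mem_iInter.1 hg (i, n)

/-- The basic characters generate the character group, so they separate the points of `G`. -/
theorem toProfiniteInt_injective [IsTopologicalGroup G] [CompactSpace G] [T2Space G]
    [TotallyDisconnectedSpace G] (hcomm : ∀ a b : G, a * b = b * a) :
    Function.Injective (toProfiniteInt e) := by
  rw [injective_iff_map_eq_one]
  intro g hg
  by_contra hne
  obtain ⟨χ, hχ⟩ := characterGroup.exists_ne_zero hcomm hne
  refine hχ ?_
  have hb : ∀ i, ∀ q : RatModInt, (e.symm (Finsupp.single i q)).1 g = 0 := by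
    intro i q
    obtain ⟨n, hn, hq⟩ := RatModInt.exists_nsmul_eq_zero q
    obtain ⟨b, rfl⟩ := RatModInt.exists_ofZMod_eq hn hq
    obtain ⟨k, rfl⟩ := ZMod.intCast_surjective b
    have h1 : (basicCharacter e i n).1 g = 0 := by
      rw [← ofZMod_basicCoord e i hn]
      have := toProfiniteInt_apply e g i ⟨n, hn⟩
      rw [hg] at this
      rw [← show _ = basicCoord e i n g from this]
      exact map_zero _
    rw [RatModInt.ofZMod_intCast, ← Finsupp.smul_single, map_zsmul]
    change k • (basicCharacter e i n).1 g = 0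
    rw [h1, smul_zero]
  rw [← e.symm_apply_apply χ]
  induction e χ using Finsupp.induction_linear with
  | zero => simp
  | add x y hx hy =>
    rw [map_add]
    change (e.symm x).1 g + (e.symm y).1 g = 0
    rw [hx, hy, add_zero]
  | single i q => exact hb i q

end Dual

instance : T2Space ProfiniteInt := inferInstanceAs (T2Space (Subtype _))

/-- A commutative profinite group whose character group is a direct sum of copies of `ℚ/ℤ`, indexed
by `I`, is a product of copies of `Ẑ` indexed by `I`. -/
theorem nonempty_continuousMulEquiv_profiniteInt {G : Type u} [Group G] [TopologicalSpace G]
    {I : Type v} (hG : IsProAbelian G) (e : characterGroup G ≃+ (I →₀ RatModInt)) :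
    Nonempty (G ≃ₜ* Multiplicative (I → ProfiniteInt)) := by
  have := hG.isTopologicalGroup
  have := hG.compactSpace
  have := hG.t2Space
  have := hG.totallyDisconnectedSpace
  have hbij : Function.Bijective (toProfiniteInt e) :=
    ⟨toProfiniteInt_injective e hG.mul_comm, toProfiniteInt_surjective e⟩
  have : T2Space (Multiplicative (I → ProfiniteInt)) :=
    inferInstanceAs (T2Space (I → ProfiniteInt))
  let h := Continuous.homeoOfEquivCompactToT2 (f := Equiv.ofBijective _ hbij)
    (continuous_toProfiniteInt e)
  exact ⟨{ MulEquiv.ofBijective (toProfiniteInt e) hbij with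
    continuous_toFun := h.continuous
    continuous_invFun := h.symm.continuous }⟩

/-! ### The free pro-abelian group `Ẑ^I` -/

namespace ProfiniteInt

/-- The topological generator `1` of `Ẑ`. -/
def one : ProfiniteInt := ⟨fun _ => 1, fun _ _ h => map_one (ZMod.castHom h _)⟩

instance : CompactSpace ProfiniteInt := by
  have : IsClosed (ProfiniteInt : Set (∀ n : ℕ+, ZMod (n : ℕ))) := by
    have h : (ProfiniteInt : Set (∀ n : ℕ+, ZMod (n : ℕ))) =
        ⋂ (m : ℕ+) (n : ℕ+) (h : (m : ℕ) ∣ n),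
          {x | ZMod.castHom h (ZMod (m : ℕ)) (x n) = x m} := by
      ext x
      simp only [Set.mem_iInter, Set.mem_ofPred_eq]
      rfl
    rw [h]
    refine isClosed_iInter fun m => isClosed_iInter fun n => isClosed_iInter fun h => ?_
    exact isClosed_eq ((continuous_of_discreteTopology (f := ZMod.castHom h (ZMod (m : ℕ)))).comp
      (continuous_apply n)) (continuous_apply m)
  exact isCompact_iff_compactSpace.1 this.isCompact

instance : TotallyDisconnectedSpace ProfiniteInt :=
  inferInstanceAs (TotallyDisconnectedSpace (Subtype _))

theorem apply_eq_of_dvd {y z : ProfiniteInt} {m n : ℕ+} (h : m ∣ n) (hyz : y.1 n = z.1 n) :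
    y.1 m = z.1 m := by
  have := congrArg (ZMod.castHom (PNat.dvd_iff.1 h) (ZMod (m : ℕ))) hyz
  rwa [y.2 _ _ (PNat.dvd_iff.1 h), z.2 _ _ (PNat.dvd_iff.1 h)] at this

/-- A neighbourhood of `z` in `Ẑ` contains a residue class of `z` modulo some `n`. -/
theorem exists_nhds {z : ProfiniteInt} {U : Set ProfiniteInt} (hU : U ∈ nhds z) :
    ∃ n : ℕ+, ∀ y : ProfiniteInt, y.1 n = z.1 n → y ∈ U := by
  rw [nhds_subtype_eq_comap, Filter.mem_comap] at hU
  obtain ⟨V, hV, hVU⟩ := hU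
  rw [nhds_pi, Filter.mem_pi] at hV
  obtain ⟨s, hs, t, ht, hst⟩ := hV
  refine ⟨∏ p ∈ hs.toFinset, p, fun y hy => hVU (hst fun p hp => ?_)⟩
  have hdvd : p ∣ ∏ p ∈ hs.toFinset, p := Finset.dvd_prod_of_mem id (hs.mem_toFinset.2 hp)
  change y.1 p ∈ t p
  rw [apply_eq_of_dvd hdvd hy]
  exact mem_of_mem_nhds (ht p)

end ProfiniteInt

theorem isProAbelian_multiplicative_profiniteInt (I : Type v) :
    IsProAbelian (Multiplicative (I → ProfiniteInt)) where
  isTopologicalGroup := inferInstance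
  compactSpace := inferInstanceAs (CompactSpace (I → ProfiniteInt))
  t2Space := inferInstanceAs (T2Space (I → ProfiniteInt))
  totallyDisconnectedSpace := inferInstanceAs (TotallyDisconnectedSpace (I → ProfiniteInt))
  mul_comm := mul_comm

/-- The standard basis of `Ẑ^I`. -/
noncomputable def profiniteBasis {I : Type v} (i : I) : Multiplicative (I → ProfiniteInt) :=
  open scoped Classical in Multiplicative.ofAdd (Pi.single i ProfiniteInt.one)

section FreeProAbelian

variable {I : Type v}

/-- A neighbourhood of `z` in `Ẑ^I` contains all elements congruent to `z` modulo some `n` at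
finitely many coordinates. -/
theorem exists_nhds_profiniteInt {z : Multiplicative (I → ProfiniteInt)}
    {U : Set (Multiplicative (I → ProfiniteInt))} (hU : U ∈ nhds z) :
    ∃ (F : Finset I) (n : ℕ+), ∀ y : Multiplicative (I → ProfiniteInt),
      (∀ i ∈ F, (y.toAdd i).1 n = (z.toAdd i).1 n) → y ∈ U := by
  classical
  have hU' : Multiplicative.ofAdd ⁻¹' U ∈ nhds z.toAdd :=
    continuous_ofAdd.continuousAt.preimage_mem_nhds hU
  rw [nhds_pi, Filter.mem_pi] at hU'
  obtain ⟨s, hs, t, ht, hst⟩ := hU'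
  choose n hn using fun i => ProfiniteInt.exists_nhds (ht i)
  refine ⟨hs.toFinset, ∏ i ∈ hs.toFinset, n i, fun y hy =>
    hst (a := y.toAdd) fun i hi => hn i _ ?_⟩
  have hi' : i ∈ hs.toFinset := hs.mem_toFinset.2 hi
  exact ProfiniteInt.apply_eq_of_dvd (Finset.dvd_prod_of_mem n hi') (hy i hi')

theorem profiniteBasis_apply_self (i : I) (n : ℕ+) : ((profiniteBasis i).toAdd i).1 n = 1 := by
  simp [profiniteBasis, ProfiniteInt.one]

theorem profiniteBasis_apply_of_ne {i j : I} (h : j ≠ i) :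
    (profiniteBasis i).toAdd j = 0 := by
  simp [profiniteBasis, h]

theorem tendsto_profiniteBasis :
    Filter.Tendsto (profiniteBasis (I := I)) Filter.cofinite (nhds 1) := by
  intro U hU
  obtain ⟨F, n, h⟩ := exists_nhds_profiniteInt hU
  rw [Filter.mem_map, Filter.mem_cofinite]
  refine F.finite_toSet.subset fun i hi => ?_
  by_contra hiF
  refine hi (h _ fun j hj => ?_)
  rw [profiniteBasis_apply_of_ne (by rintro rfl; exact hiF hj)]
  rfl

/-- The standard basis generates `Ẑ^I` topologically. -/
theorem topologicalClosure_profiniteBasis :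
    (Subgroup.closure (Set.range (profiniteBasis (I := I)))).topologicalClosure = ⊤ := by
  classical
  rw [eq_top_iff]
  intro z _
  change z ∈ closure _
  rw [mem_closure_iff_nhds]
  intro U hU
  obtain ⟨F, n, h⟩ := exists_nhds_profiniteInt hU
  choose k hk using fun i => ZMod.intCast_surjective ((z.toAdd i).1 n)
  refine ⟨∏ i ∈ F, profiniteBasis i ^ k i, h _ fun i hi => ?_, ?_⟩
  · rw [toAdd_prod, Finset.sum_apply, Finset.sum_eq_single_of_mem i hi]
    · rw [toAdd_zpow, Pi.smul_apply, AddSubgroup.coe_zsmul, Pi.smul_apply,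
        profiniteBasis_apply_self, ← hk, zsmul_one]
    · intro j _ hj
      rw [toAdd_zpow, Pi.smul_apply, profiniteBasis_apply_of_ne hj.symm, smul_zero]
  · exact Subgroup.prod_mem _ fun i _ =>
      Subgroup.zpow_mem _ (Subgroup.subset_closure (Set.mem_range_self i)) _

/-- A family in a finite discrete abelian group with finite support extends to a continuous
homomorphism on `Ẑ^I`. -/
theorem exists_lift_of_finite {B : Type w} [CommGroup B] [Finite B] [TopologicalSpace B]
    [DiscreteTopology B] (b : I → B) (hb : {i | b i ≠ 1}.Finite) :
    ∃ φ : Multiplicative (I → ProfiniteInt) →* B, Continuous φ ∧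
      ∀ i, φ (profiniteBasis i) = b i := by
  classical
  let n : ℕ+ := ⟨Nat.card B, Nat.card_pos⟩
  let ev : I → (I → ProfiniteInt) →+ ZMod n := fun i =>
    (Pi.evalAddMonoidHom (fun n : ℕ+ => ZMod n) n).comp
      (ProfiniteInt.subtype.comp (Pi.evalAddMonoidHom _ i))
  have hn : ∀ i, zmultiplesHom (Additive B) (Additive.ofMul (b i)) ((n : ℕ) : ℤ) = 0 := fun i => by
    rw [zmultiplesHom_apply, natCast_zsmul]
    exact congrArg Additive.ofMul (pow_card_eq_one' (G := B))
  let pow : I → ZMod n →+ Additive B := fun i => ZMod.lift (n : ℕ) ⟨zmultiplesHom _ _, hn i⟩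
  let ψ : I → Multiplicative (I → ProfiniteInt) →* B := fun i =>
    AddMonoidHom.toMultiplicativeLeft ((pow i).comp (ev i))
  have hψ : ∀ i z, ψ i z = (pow i ((z.toAdd i).1 n)).toMul := fun _ _ => rfl
  refine ⟨∏ i ∈ hb.toFinset, ψ i, ?_, fun i => ?_⟩
  · have : ⇑(∏ i ∈ hb.toFinset, ψ i) = fun z => ∏ i ∈ hb.toFinset, ψ i z := by
      funext z; simp
    rw [this]
    refine continuous_finsetProd _ fun i _ => ?_
    have hc : Continuous fun z : Multiplicative (I → ProfiniteInt) => (z.toAdd i).1 n :=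
      (continuous_apply n).comp (continuous_subtype_val.comp
        ((continuous_apply i).comp continuous_toAdd))
    exact (continuous_of_discreteTopology (f := fun a => (pow i a).toMul)).comp hc
  · have h1 : ∀ j, j ≠ i → ψ j (profiniteBasis i) = 1 := fun j hj => by
      rw [hψ, profiniteBasis_apply_of_ne hj]
      exact congrArg Additive.toMul (map_zero (pow j))
    have h2 : ψ i (profiniteBasis i) = b i := by
      rw [hψ, profiniteBasis_apply_self, ← Int.cast_one, ZMod.lift_coe]
      simp
    rw [MonoidHom.finsetProd_apply]
    by_cases hi : b i = 1
    · rw [hi]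
      refine Finset.prod_eq_one fun j _ => ?_
      rcases eq_or_ne j i with rfl | hj
      · rw [h2, hi]
      · exact h1 j hj
    · rw [Finset.prod_eq_single_of_mem i (hb.mem_toFinset.2 hi) fun j _ hj => h1 j hj, h2]

/-- `Ẑ^I` is free on the standard basis. The graph of the extension of a family `f` is the closed
subgroup generated by the pairs `(e_i, f i)`: it projects onto `Ẑ^I` by density and compactness, and
injectively because modulo every open subgroup of the target the extension is a finite product. -/
theorem isFreeProAbelianOn_profiniteBasis :
    IsFreeProAbelianOn.{w} (profiniteBasis (I := I)) where
  isProAbelian := isProAbelian_multiplicative_profiniteInt I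
  tendsto := tendsto_profiniteBasis
  existsUnique_lift := by
    intro A _ _ hA f hf
    have := hA.isTopologicalGroup
    have := hA.compactSpace
    have := hA.t2Space
    have := hA.totallyDisconnectedSpace
    have hP := isProAbelian_multiplicative_profiniteInt I
    have := hP.compactSpace
    have := hP.t2Space
    let _ : CommGroup A := { (inferInstance : Group A) with mul_comm := hA.mul_comm }
    let P := Multiplicative (I → ProfiniteInt)
    let Γ : Subgroup (P × A) :=
      (Subgroup.closure (Set.range fun i => ((profiniteBasis i : P), f i))).topologicalClosure
    have hΓc : IsClosed (Γ : Set (P × A)) := Subgroup.isClosed_topologicalClosure _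
    have : CompactSpace Γ := isCompact_iff_compactSpace.1 hΓc.isCompact
    have hmem : ∀ i, ((profiniteBasis i : P), f i) ∈ Γ := fun i =>
      Subgroup.le_topologicalClosure _ (Subgroup.subset_closure ⟨i, rfl⟩)
    let π : Γ →* P := (MonoidHom.fst P A).comp Γ.subtype
    have hπc : Continuous π := continuous_fst.comp continuous_subtype_val
    have hπs : Function.Surjective π := by
      have hcl : IsClosed (π.range : Set P) := by
        rw [MonoidHom.coe_range]
        exact (isCompact_range hπc).isClosed
      rw [← MonoidHom.range_eq_top, eq_top_iff, ← topologicalClosure_profiniteBasis]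
      refine Subgroup.topologicalClosure_minimal _ ?_ hcl
      rw [Subgroup.closure_le]
      rintro _ ⟨i, rfl⟩
      exact ⟨⟨_, hmem i⟩, rfl⟩
    have hπi : Function.Injective π := by
      rw [injective_iff_map_eq_one]
      rintro ⟨⟨z, a⟩, hza⟩ hz
      obtain rfl : z = 1 := hz
      have ha : a = 1 := by
        by_contra ha
        obtain ⟨U, hU⟩ := ProfiniteGrp.exist_openNormalSubgroup_sub_open_nhds_of_one
          (isOpen_compl_singleton (x := a)) (show (1 : A) ∈ ({a}ᶜ : Set A) from fun h => ha h.symm)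
        have : DiscreteTopology (A ⧸ U.toSubgroup) := QuotientGroup.discreteTopology U.isOpen'
        have : Finite (A ⧸ U.toSubgroup) := finite_of_compact_of_discrete
        obtain ⟨φ, hφc, hφ⟩ := exists_lift_of_finite (I := I)
          (fun i => (f i : A ⧸ U.toSubgroup)) (by
            have := hf (U.isOpen'.mem_nhds U.one_mem)
            rw [Filter.mem_map, Filter.mem_cofinite] at this
            refine this.subset fun i hi hiU => hi ((QuotientGroup.eq_one_iff _).2 hiU))
        let E : Subgroup (P × A) := (φ.comp (MonoidHom.fst P A)).eqLocus
          ((QuotientGroup.mk' U.toSubgroup).comp (MonoidHom.snd P A))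
        have hE : IsClosed (E : Set (P × A)) :=
          isClosed_eq (hφc.comp continuous_fst) (QuotientGroup.continuous_mk.comp continuous_snd)
        have hΓE : Γ ≤ E := by
          refine Subgroup.topologicalClosure_minimal _ ?_ hE
          rw [Subgroup.closure_le]
          rintro _ ⟨i, rfl⟩
          exact hφ i
        have h1 : φ 1 = (a : A ⧸ U.toSubgroup) := hΓE hza
        rw [map_one] at h1
        exact hU ((QuotientGroup.eq_one_iff a).1 h1.symm) rfl
      exact Subtype.ext (Prod.ext rfl ha)
    let e : Γ ≃* P := MulEquiv.ofBijective π ⟨hπi, hπs⟩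
    let h := Continuous.homeoOfEquivCompactToT2 (f := Equiv.ofBijective _ ⟨hπi, hπs⟩) hπc
    have hec : Continuous e.symm := h.symm.continuous
    have hlift : ∀ i, (e.symm (profiniteBasis i)).1.2 = f i := fun i => by
      have : e.symm (profiniteBasis i) = ⟨_, hmem i⟩ := by
        rw [MulEquiv.symm_apply_eq]
        rfl
      rw [this]
    refine ⟨⟨(MonoidHom.snd P A).comp (Γ.subtype.comp e.symm.toMonoidHom),
      continuous_snd.comp (continuous_subtype_val.comp hec)⟩, hlift, fun ψ hψ => ?_⟩
    let E : Subgroup P := (ψ : P →* A).eqLocus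
      ((MonoidHom.snd P A).comp (Γ.subtype.comp e.symm.toMonoidHom))
    have hE : IsClosed (E : Set P) := isClosed_eq ψ.continuous_toFun
      (continuous_snd.comp (continuous_subtype_val.comp hec))
    have hE' : ⊤ ≤ E := by
      rw [← topologicalClosure_profiniteBasis]
      refine Subgroup.topologicalClosure_minimal _ ?_ hE
      rw [Subgroup.closure_le]
      rintro _ ⟨i, rfl⟩
      exact (hψ i).trans (hlift i).symm
    ext z
    exact hE' (Subgroup.mem_top z)

end FreeProAbelian

/-- Freeness is transported along isomorphisms of topological groups. -/
theorem IsFreeProAbelianOn.of_continuousMulEquiv {X : Type u} {G : Type v} {H : Type*} [Group G]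
    [TopologicalSpace G] [Group H] [TopologicalSpace H] {ι : X → G}
    (h : IsFreeProAbelianOn.{w} ι) (hH : IsProAbelian H) (e : G ≃ₜ* H) :
    IsFreeProAbelianOn.{w} (fun x => e (ι x)) where
  isProAbelian := hH
  tendsto := by
    have := (e.continuous_toFun.tendsto 1).comp h.tendsto
    rwa [show e.toFun 1 = 1 from map_one e] at this
  existsUnique_lift := by
    intro A _ _ hA f hf
    obtain ⟨φ, hφ, hu⟩ := h.existsUnique_lift A hA f hf
    refine ⟨φ.comp (e.symm : H →ₜ* G), fun x => by simpa using hφ x, fun ψ hψ => ?_⟩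
    have := hu (ψ.comp (e : G →ₜ* H)) fun x => hψ x
    ext y
    rw [← this]
    simp

/-! ### Characters of the maximal abelian extension -/

section Galois

variable {F : Type u} {E : Type v} [Field F] [Field E] [Algebra F E]

/-- The kernel of a character, as a subgroup. -/
def characterGroup.ker {G : Type*} [Group G] [TopologicalSpace G] (χ : characterGroup G) :
    Subgroup G where
  carrier := {g | χ.1 g = 0}
  one_mem' := map_one χ
  mul_mem' := fun {a b} ha hb => by
    change χ.1 (a * b) = 0
    rw [map_mul, show χ.1 a = 0 from ha, show χ.1 b = 0 from hb, add_zero]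
  inv_mem' := fun {a} ha => by
    have h := characterGroup.map_mul χ a a⁻¹
    rw [mul_inv_cancel, map_one, show χ.1 a = 0 from ha, zero_add] at h
    exact h.symm

/-- A character of a Galois group factors through the Galois group of a finite abelian
subextension. -/
theorem characterGroup.exists_isAbelianGalois [IsGalois F E] (χ : characterGroup Gal(E/F)) :
    ∃ K : IntermediateField F E, FiniteDimensional F K ∧ IsAbelianGalois F K ∧
      ∀ σ ∈ K.fixingSubgroup, χ.1 σ = 0 := by
  have hopen : IsOpen ((characterGroup.ker χ) : Set Gal(E/F)) := χ.2.1.isOpen_fiber 0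
  let H : ClosedSubgroup Gal(E/F) :=
    { (characterGroup.ker χ) with isClosed' := Subgroup.isClosed_of_isOpen _ hopen }
  let K := IntermediateField.fixedField (characterGroup.ker χ)
  have hK : K.fixingSubgroup = (characterGroup.ker χ) := InfiniteGalois.fixingSubgroup_fixedField H
  have hnormal : (characterGroup.ker χ).Normal := ⟨fun a ha b => by
    change χ.1 (b * a * b⁻¹) = 0
    have h := characterGroup.map_mul χ b b⁻¹
    rw [mul_inv_cancel, map_one] at h
    rw [map_mul, map_mul, show χ.1 a = 0 from ha, add_zero, ← h]⟩
  have hgal : IsGalois F K := (InfiniteGalois.normal_iff_isGalois K).1 (hK ▸ hnormal)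
  refine ⟨K, (InfiniteGalois.isOpen_iff_finite K).1 (hK ▸ hopen), { is_comm := ⟨fun a b => ?_⟩ },
    fun σ hσ => (hK ▸ hσ : σ ∈ (characterGroup.ker χ))⟩
  -- the commutator of `a` and `b` lies in the kernel of `χ`, which is the fixing subgroup of `K`
  obtain ⟨a, rfl⟩ := AlgEquiv.restrictNormalHom_surjective E a
  obtain ⟨b, rfl⟩ := AlgEquiv.restrictNormalHom_surjective E b
  rw [← _root_.map_mul, ← _root_.map_mul, ← mul_inv_eq_one, ← map_inv, ← _root_.map_mul,
    ← MonoidHom.mem_ker, IntermediateField.restrictNormalHom_ker, hK]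
  change χ.1 (a * b * (b * a)⁻¹) = 0
  have h := characterGroup.map_mul χ (b * a) (b * a)⁻¹
  rw [mul_inv_cancel, map_one] at h
  rw [map_mul, map_mul χ a b, h, map_mul χ b a]
  abel

variable (F)

/-- Commutators of automorphisms fix every abelian extension, hence also their compositum. -/
theorem isAbelianGalois_maximalAbelianExtension [IsGalois F (AlgebraicClosure F)] :
    IsAbelianGalois F (maximalAbelianExtension F) := by
  have hnormal : Normal F (maximalAbelianExtension F) := by
    have h : ∀ K : {K : IntermediateField F (AlgebraicClosure F) // IsAbelianGalois F K},
        Normal F K.1 := fun K => by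
      have := K.2
      infer_instance
    rw [maximalAbelianExtension, iSup_subtype']
    exact IntermediateField.normal_iSup F (AlgebraicClosure F) _
  have hgal : IsGalois F (maximalAbelianExtension F) := {}
  refine { is_comm := ⟨fun a b => ?_⟩ }
  obtain ⟨a, rfl⟩ := AlgEquiv.restrictNormalHom_surjective (AlgebraicClosure F) a
  obtain ⟨b, rfl⟩ := AlgEquiv.restrictNormalHom_surjective (AlgebraicClosure F) b
  rw [← map_mul, ← map_mul, ← mul_inv_eq_one, ← map_inv, ← map_mul,
    ← MonoidHom.mem_ker, IntermediateField.restrictNormalHom_ker]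
  rw [← Subgroup.zpowers_le, ← IntermediateField.le_iff_le]
  refine iSup₂_le fun K hK => ?_
  rw [IntermediateField.le_iff_le, Subgroup.zpowers_le, ← IntermediateField.restrictNormalHom_ker,
    MonoidHom.mem_ker, map_mul, map_inv, map_mul, map_mul, mul_inv_eq_one]
  exact hK.is_comm.comm _ _

theorem isProAbelian_maximalAbelianGaloisGroup [IsGalois F (AlgebraicClosure F)] :
    IsProAbelian (maximalAbelianGaloisGroup F) := by
  have := isAbelianGalois_maximalAbelianExtension F
  exact ⟨inferInstance, inferInstance, inferInstance, inferInstance,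
    fun a b => this.is_comm.comm a b⟩

/-- Restriction of automorphisms identifies the characters of `Gal(F^ab/F)` with those of the
absolute Galois group. -/
theorem nonempty_characterGroup_maximalAbelian [IsGalois F (AlgebraicClosure F)] :
    Nonempty (characterGroup (maximalAbelianGaloisGroup F) ≃+
      characterGroup Gal(AlgebraicClosure F/F)) := by
  have := isAbelianGalois_maximalAbelianExtension F
  let r : Gal(AlgebraicClosure F/F) →* maximalAbelianGaloisGroup F :=
    AlgEquiv.restrictNormalHom (maximalAbelianExtension F)
  have hr : Function.Surjective r := AlgEquiv.restrictNormalHom_surjective _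
  have hrc : Continuous r := InfiniteGalois.restrictNormalHom_continuous _
  have hq : Topology.IsQuotientMap r := hrc.isClosedMap.isQuotientMap hrc hr
  let Φ : characterGroup (maximalAbelianGaloisGroup F) →+
      characterGroup Gal(AlgebraicClosure F/F) :=
    { toFun := fun χ => ⟨χ.1 ∘ r, χ.2.1.comp_continuous hrc, fun a b => by
        simp only [Function.comp_apply, map_mul, χ.2.2]⟩
      map_zero' := rfl
      map_add' := fun _ _ => rfl }
  refine ⟨AddEquiv.ofBijective Φ ⟨?_, fun ψ => ?_⟩⟩
  · intro χ₁ χ₂ h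
    ext g
    obtain ⟨g, rfl⟩ := hr g
    exact congrFun (congrArg Subtype.val h) g
  · obtain ⟨K, -, hab, hK⟩ := characterGroup.exists_isAbelianGalois ψ
    have hle : K ≤ maximalAbelianExtension F := le_iSup₂_of_le K hab le_rfl
    have hfac : ∀ a b, r a = r b → ψ.1 a = ψ.1 b := by
      intro a b hab
      have h1 : a * b⁻¹ ∈ K.fixingSubgroup := by
        refine IntermediateField.fixingSubgroup_le hle ?_
        rw [← IntermediateField.restrictNormalHom_ker, MonoidHom.mem_ker]
        change r (a * b⁻¹) = 1
        rw [map_mul, map_inv, hab, mul_inv_cancel]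
      have h2 := characterGroup.map_mul ψ (a * b⁻¹) b
      rwa [hK _ h1, zero_add, inv_mul_cancel_right] at h2
    let χ := ψ.1 ∘ Function.surjInv hr
    have hχ : ∀ a, χ (r a) = ψ.1 a := fun a => hfac _ _ (Function.surjInv_eq hr _)
    refine ⟨⟨χ, fun s => ?_, fun a b => ?_⟩, Subtype.ext (funext hχ)⟩
    · rw [← hq.isOpen_preimage, ← Set.preimage_comp, show χ ∘ r = ψ.1 from funext hχ]
      exact ψ.2.1 s
    · obtain ⟨a, rfl⟩ := hr a
      obtain ⟨b, rfl⟩ := hr b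
      rw [← map_mul, hχ, hχ, hχ, characterGroup.map_mul]

end Galois

/-! ### Kummer theory -/

section Characters

variable {F : Type u} {E : Type v} [Field F] [Field E] [Algebra F E]

/-- An additive function on a Galois group that is trivial on the automorphisms fixing a finite
subextension is a character. -/
theorem mem_characterGroup_of_fixingSubgroup {ψ : Gal(E/F) → RatModInt}
    (hψ : ∀ σ τ, ψ (σ * τ) = ψ σ + ψ τ) (K : IntermediateField F E) [FiniteDimensional F K]
    (hK : ∀ σ ∈ K.fixingSubgroup, ψ σ = 0) : ψ ∈ characterGroup Gal(E/F) := by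
  refine ⟨(IsLocallyConstant.iff_exists_open ψ).2 fun σ => ?_, hψ⟩
  refine ⟨(fun τ => σ⁻¹ * τ) ⁻¹' K.fixingSubgroup,
    (IntermediateField.fixingSubgroup_isOpen K).preimage (continuous_const_mul σ⁻¹), ?_, ?_⟩
  · simp [K.fixingSubgroup.one_mem]
  · intro τ hτ
    have := hψ σ (σ⁻¹ * τ)
    rwa [mul_inv_cancel_left, hK _ hτ, add_zero] at this

/-- A character killed by `n` takes values in `ℤ/n`, and factors through a finite Galois group. -/
theorem characterGroup.exists_zmod [IsGalois F E] (χ : characterGroup Gal(E/F)) {n : ℕ}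
    (hn : 0 < n) (hχ : n • χ = 0) :
    ∃ K : IntermediateField F E, FiniteDimensional F K ∧ IsGalois F K ∧
      ∃ c : Gal(K/F) → ZMod n, (∀ σ τ, c (σ * τ) = c σ + c τ) ∧ ∀ σ : Gal(E/F),
        ∀ s : Gal(K/F), (∀ x : K, ((s x : K) : E) = σ x) → RatModInt.ofZMod n (c s) = χ.1 σ := by
  obtain ⟨K, hfin, hab, hK⟩ := characterGroup.exists_isAbelianGalois χ
  refine ⟨K, hfin, inferInstance, ?_⟩
  let r : Gal(E/F) →* Gal(K/F) := AlgEquiv.restrictNormalHom K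
  have hr : Function.Surjective r := AlgEquiv.restrictNormalHom_surjective E
  have hfac : ∀ a b, r a = r b → χ.1 a = χ.1 b := by
    intro a b hab
    have h1 : a * b⁻¹ ∈ K.fixingSubgroup := by
      rw [← IntermediateField.restrictNormalHom_ker, MonoidHom.mem_ker]
      change r (a * b⁻¹) = 1
      rw [_root_.map_mul, map_inv, hab, mul_inv_cancel]
    have h2 := characterGroup.map_mul χ (a * b⁻¹) b
    rwa [hK _ h1, zero_add, inv_mul_cancel_right] at h2
  have hval : ∀ s : Gal(K/F), ∃ a : ZMod n, ∀ σ, r σ = s → RatModInt.ofZMod n a = χ.1 σ := by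
    intro s
    obtain ⟨σ, rfl⟩ := hr s
    obtain ⟨a, ha⟩ := RatModInt.exists_ofZMod_eq hn (congrFun (congrArg Subtype.val hχ) σ)
    exact ⟨a, fun τ hτ => ha.trans (hfac _ _ hτ.symm)⟩
  choose c hc using hval
  refine ⟨c, fun s t => ?_, fun σ s hs => hc s σ ?_⟩
  · obtain ⟨σ, rfl⟩ := hr s
    obtain ⟨τ, rfl⟩ := hr t
    apply RatModInt.ofZMod_injective hn
    rw [map_add, hc _ σ rfl, hc _ τ rfl, hc _ (σ * τ) (_root_.map_mul r σ τ),
      characterGroup.map_mul]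
  · ext x
    rw [hs x]
    exact AlgEquiv.restrictNormal_commutes σ K x

end Characters

section Kummer

variable {F : Type u} {E : Type v} [Field F] [Field E] [Algebra F E]

theorem IsPrimitiveRoot.pow_val_add {ζ : F} {n : ℕ} [NeZero n] (hζ : IsPrimitiveRoot ζ n)
    (a b : ZMod n) : ζ ^ (a + b).val = ζ ^ a.val * ζ ^ b.val := by
  have h := pow_mod_orderOf ζ (a.val + b.val)
  rw [← hζ.eq_orderOf] at h
  rw [← pow_add, ZMod.val_add, h]

theorem IsPrimitiveRoot.pow_val_injective {ζ : F} {n : ℕ} [NeZero n] (hζ : IsPrimitiveRoot ζ n) :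
    Function.Injective fun a : ZMod n => ζ ^ a.val := fun a b h =>
  ZMod.val_injective n (hζ.pow_inj (ZMod.val_lt a) (ZMod.val_lt b) h)

/-- Characters killed by `n` are Kummer characters, by Hilbert's Theorem 90. -/
theorem exists_kummer_generator [IsGalois F E] {n : ℕ} [NeZero n] {ζ : F}
    (hζ : IsPrimitiveRoot ζ n) (χ : characterGroup Gal(E/F)) (hχ : n • χ = 0) :
    ∃ α : E, α ≠ 0 ∧ ∀ σ : Gal(E/F), ∃ a : ZMod n, RatModInt.ofZMod n a = χ.1 σ ∧
      σ α = algebraMap F E (ζ ^ a.val) * α := by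
  obtain ⟨K, _, _, c, hc, hcχ⟩ := characterGroup.exists_zmod χ (NeZero.pos n) hχ
  have hζ0 : ζ ≠ 0 := hζ.ne_zero (NeZero.ne n)
  let f : Gal(K/F) → Kˣ := fun s => Units.map (algebraMap F K : F →* K)
    (Units.mk0 ζ hζ0 ^ (c s).val)
  have hf : groupCohomology.IsMulCocycle₁ f := by
    intro s t
    ext
    simp only [f, hc, AlgEquiv.smul_units_def]
    simp only [Units.val_mul, Units.coe_map, Units.val_pow_eq_pow_val, Units.val_mk0, map_pow,
      MonoidHom.coe_coe, AlgEquiv.commutes]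
    rw [← map_pow, hζ.pow_val_add, map_mul, map_pow, map_pow, mul_comm]
  obtain ⟨β, hβ⟩ := groupCohomology.isMulCoboundary₁_of_isMulCocycle₁_of_aut_to_units f hf
  refine ⟨(β : K), by simp, fun σ => ⟨c (AlgEquiv.restrictNormalHom K σ),
    hcχ _ _ fun x => AlgEquiv.restrictNormal_commutes σ K x, ?_⟩⟩
  have h := hβ (AlgEquiv.restrictNormalHom K σ)
  rw [div_eq_iff_eq_mul] at h
  have h' := congrArg (fun u : Kˣ => ((u : K) : E)) h
  simp only [f, AlgEquiv.smul_units_def, Units.coe_map, Units.val_mul] at h'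
  have h2 := AlgEquiv.restrictNormal_commutes σ K (β : K)
  refine h2.symm.trans (h'.trans ?_)
  simp

/-- The Kummer character attached to an `n`-th root `α` of an element of `F`. -/
theorem exists_kummer_character [IsGalois F E] {n : ℕ} [NeZero n] {ζ : F}
    (hζ : IsPrimitiveRoot ζ n) {α : E} (hα : α ≠ 0) (hαn : ∀ σ : Gal(E/F), σ (α ^ n) = α ^ n) :
    ∃ χ : characterGroup Gal(E/F), n • χ = 0 ∧ ∀ σ : Gal(E/F), ∃ a : ZMod n,
      RatModInt.ofZMod n a = χ.1 σ ∧ σ α = algebraMap F E (ζ ^ a.val) * α := by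
  have hζE := hζ.map_of_injective (FaithfulSMul.algebraMap_injective F E)
  have h : ∀ σ : Gal(E/F), ∃ a : ZMod n, σ α = algebraMap F E (ζ ^ a.val) * α := by
    intro σ
    have h1 : (σ α / α) ^ n = 1 := by
      rw [div_pow, ← map_pow, hαn, div_self (pow_ne_zero n hα)]
    obtain ⟨k, hk, hkα⟩ := hζE.eq_pow_of_pow_eq_one h1
    refine ⟨(k : ZMod n), ?_⟩
    rw [ZMod.val_natCast_of_lt hk, map_pow, hkα, div_mul_cancel₀ _ hα]
  choose d hd using h
  have hinj : ∀ a b : ZMod n,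
      algebraMap F E (ζ ^ a.val) * α = algebraMap F E (ζ ^ b.val) * α → a = b := fun a b hab =>
    hζ.pow_val_injective (FaithfulSMul.algebraMap_injective F E (mul_right_cancel₀ hα hab))
  have hα' : IsIntegral F α := (Algebra.IsIntegral.isIntegral (R := F) α)
  have := IntermediateField.adjoin.finiteDimensional hα'
  refine ⟨⟨fun σ => RatModInt.ofZMod n (d σ), mem_characterGroup_of_fixingSubgroup
    (fun σ τ => ?_) (IntermediateField.adjoin F {α}) fun σ hσ => ?_⟩, ?_, fun σ => ⟨d σ, rfl, hd σ⟩⟩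
  · rw [← map_add]
    congr 1
    apply hinj
    rw [← hd, hζ.pow_val_add, AlgEquiv.mul_apply, hd τ, map_mul, AlgEquiv.commutes, hd σ, map_mul]
    ring
  · rw [show d σ = 0 from hinj _ _ ?_, map_zero]
    rw [← hd]
    have := hσ ⟨α, IntermediateField.mem_adjoin_simple_self F α⟩
    simpa using this
  · ext σ
    exact RatModInt.nsmul_ofZMod n (d σ)

/-- In the presence of roots of unity of order `n * ℓ`, every character killed by `n` is divisible
by `ℓ`: an `ℓ`-th root of its Kummer generator defines a Kummer character modulo `n * ℓ`. -/
theorem exists_nsmul_eq_of_isPrimitiveRoot [IsGalois F E] [IsAlgClosed E] {n ℓ : ℕ} [NeZero n]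
    [NeZero ℓ] {ζ : F} (hζ : IsPrimitiveRoot ζ (n * ℓ)) (χ : characterGroup Gal(E/F))
    (hχ : n • χ = 0) : ∃ ψ, ℓ • ψ = χ := by
  have hζn : IsPrimitiveRoot (ζ ^ ℓ) n := hζ.pow (NeZero.pos _) (mul_comm _ _)
  obtain ⟨α, hα, h⟩ := exists_kummer_generator hζn χ hχ
  obtain ⟨β, rfl⟩ := IsAlgClosed.exists_pow_nat_eq α (NeZero.pos ℓ)
  have hβ : β ≠ 0 := by
    rintro rfl
    exact hα (zero_pow (NeZero.ne ℓ))
  have hfix : ∀ σ : Gal(E/F), σ (β ^ (n * ℓ)) = β ^ (n * ℓ) := by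
    intro σ
    obtain ⟨a, -, ha⟩ := h σ
    rw [mul_comm n, pow_mul, map_pow, ha, mul_pow, ← map_pow, ← pow_mul (ζ ^ ℓ),
      mul_comm a.val, pow_mul, hζn.pow_eq_one, one_pow, map_one, one_mul]
  obtain ⟨ψ, -, hψ⟩ := exists_kummer_character hζ hβ hfix
  refine ⟨ψ, ?_⟩
  ext σ
  obtain ⟨a, haχ, ha⟩ := h σ
  obtain ⟨b, hbψ, hb⟩ := hψ σ
  change ℓ • ψ.1 σ = χ.1 σ
  have h1 : ZMod.castHom (Dvd.intro ℓ rfl) (ZMod n) b = a := by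
    apply hζn.pow_val_injective
    apply FaithfulSMul.algebraMap_injective F E
    apply mul_right_cancel₀ hα
    have hmod := pow_mod_orderOf (ζ ^ ℓ) b.val
    rw [← hζn.eq_orderOf] at hmod
    rw [← ha, map_pow σ, hb, mul_pow, ← map_pow, ← pow_mul, mul_comm b.val, pow_mul, ← hmod]
    simp only [ZMod.castHom_apply, ZMod.cast_eq_val, ZMod.val_natCast]
  rw [← haχ, ← hbψ, ← h1, RatModInt.ofZMod_castHom (NeZero.pos (n * ℓ)),
    Nat.mul_div_cancel_left _ (NeZero.pos n)]

theorem prod_zpow_eq_zpow_sum {K S : Type*} [Field K] {x : K} (hx : x ≠ 0) (T : Finset S)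
    (c : S → ℤ) : ∏ s ∈ T, x ^ c s = x ^ ∑ s ∈ T, c s := by
  classical
  induction T using Finset.induction_on with
  | empty => simp
  | insert s T hs ih => rw [Finset.prod_insert hs, Finset.sum_insert hs, zpow_add₀ hx, ih]

open Cardinal in
/-- A character killed by `n` is determined by a Kummer generator. -/
theorem mk_torsionBy_characterGroup_le [IsGalois F E] {n : ℕ} [NeZero n] {ζ : F}
    (hζ : IsPrimitiveRoot ζ n) : #(Submodule.torsionBy ℤ (characterGroup Gal(E/F)) n) ≤ #E := by
  have h : ∀ χ : Submodule.torsionBy ℤ (characterGroup Gal(E/F)) n, n • χ.1 = 0 := fun χ =>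
    (natCast_zsmul _ _).symm.trans χ.2
  choose α hα a ha using fun χ : Submodule.torsionBy ℤ (characterGroup Gal(E/F)) n =>
    exists_kummer_generator hζ χ.1 (h χ)
  refine mk_le_of_injective (f := α) fun χ ψ hχψ => ?_
  ext σ
  rw [← (ha χ σ).1, ← (ha ψ σ).1]
  congr 1
  apply hζ.pow_val_injective
  apply FaithfulSMul.algebraMap_injective F E
  apply mul_right_cancel₀ (hα χ)
  rw [← (ha χ σ).2, hχψ, (ha ψ σ).2]

/-- A family in `F` that is independent modulo `ℓ`-th powers has independent Kummer characters. -/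
theorem exists_isIndepMod_kummer [IsGalois F E] [IsAlgClosed E] {ℓ : ℕ} (hℓ : ℓ.Prime) {ζ : F}
    (hζ : IsPrimitiveRoot ζ ℓ) {S : Type w} (a : S → F) (ha : ∀ s, a s ≠ 0)
    (hind : ∀ (T : Finset S) (c : S → ℤ) (f : F), ∏ s ∈ T, a s ^ c s = f ^ ℓ →
      ∀ s ∈ T, (ℓ : ℤ) ∣ c s) :
    ∃ χ : S → characterGroup Gal(E/F), (∀ s, (ℓ : ℤ) • χ s = 0) ∧ IsIndepMod ℓ χ := by
  have : NeZero ℓ := ⟨hℓ.ne_zero⟩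
  choose α hα using fun s => IsAlgClosed.exists_pow_nat_eq (algebraMap F E (a s)) hℓ.pos
  have hα0 : ∀ s, α s ≠ 0 := by
    intro s h
    have := hα s
    rw [h, zero_pow hℓ.ne_zero, eq_comm, map_eq_zero] at this
    exact ha s this
  choose χ hχ d hd using fun s => exists_kummer_character hζ (hα0 s) fun σ => by
    rw [hα, AlgEquiv.commutes]
  refine ⟨χ, fun s => (natCast_zsmul _ _).trans (hχ s), fun T c hc s hs => ?_⟩
  have hζ0' : algebraMap F E ζ ≠ 0 := (map_ne_zero _).2 (hζ.ne_zero hℓ.ne_zero)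
  have hsum : ∀ σ, (ℓ : ℤ) ∣ ∑ s ∈ T, c s * (d s σ).val := by
    intro σ
    have := congrFun (congrArg Subtype.val hc) σ
    rw [AddSubgroup.val_finsetSum, Finset.sum_apply] at this
    rw [← ZMod.intCast_zmod_eq_zero_iff_dvd]
    apply RatModInt.ofZMod_injective hℓ.pos
    rw [map_zero]
    refine Eq.trans ?_ this
    push_cast
    rw [map_sum]
    refine Finset.sum_congr rfl fun s _ => ?_
    change _ = c s • (χ s).1 σ
    rw [← (hd s σ).1, ← map_zsmul, zsmul_eq_mul]
    simp
  -- a relation between the characters makes the product of the roots Galois invariant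
  obtain ⟨f, hf⟩ := (InfiniteGalois.mem_range_algebraMap_iff_fixed (k := F)
    (∏ s ∈ T, α s ^ c s)).2 fun σ => by
      rw [map_prod]
      simp only [map_zpow₀, (hd _ σ).2, mul_zpow]
      rw [Finset.prod_mul_distrib]
      refine mul_eq_right₀ ?_ |>.2 ?_
      · exact Finset.prod_ne_zero_iff.2 fun s _ => zpow_ne_zero _ (hα0 s)
      · obtain ⟨k, hk⟩ := hsum σ
        have : ∀ s ∈ T, (algebraMap F E (ζ ^ (d s σ).val)) ^ c s =
            algebraMap F E ζ ^ (c s * (d s σ).val) := fun s _ => by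
          rw [map_pow, mul_comm, zpow_mul, zpow_natCast]
        rw [Finset.prod_congr rfl this]
        rw [prod_zpow_eq_zpow_sum hζ0', hk, zpow_mul, zpow_natCast, ← map_pow, hζ.pow_eq_one,
          map_one, one_zpow]
  refine hind T c f ?_ s hs
  apply FaithfulSMul.algebraMap_injective F E
  rw [map_pow, hf, map_prod, ← Finset.prod_pow]
  refine Finset.prod_congr rfl fun s _ => ?_
  rw [map_zpow₀, ← hα, ← zpow_natCast, ← zpow_natCast, zpow_comm]

end Kummer

/-! ### Artin–Schreier theory -/

section ArtinSchreier

variable {F : Type u} {E : Type v} [Field F] [Field E] [Algebra F E]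

theorem ZMod.exists_castHom_eq_of_pow_eq_self {K : Type*} [Field K] {p : ℕ} [Fact p.Prime]
    [CharP K p] {x : K} (hx : x ^ p = x) : ∃ a : ZMod p, ZMod.castHom (dvd_refl p) K a = x := by
  have h : (⊥ : Subfield K) ≤ (ZMod.castHom (dvd_refl p) K).fieldRange := bot_le
  exact h ((Subfield.mem_bot_iff_pow_eq_self K p).2 hx)

/-- The additive form of Hilbert's Theorem 90, by averaging against an element of trace one. -/
theorem exists_eq_sub_of_additive_cocycle {K : Type*} [Field K] [Algebra F K]
    [FiniteDimensional F K] [IsGalois F K] (f : Gal(K/F) → K)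
    (hf : ∀ σ τ, f (σ * τ) = f σ + σ (f τ)) : ∃ β : K, ∀ σ, σ β - β = f σ := by
  obtain ⟨y, hy⟩ := Algebra.trace_surjective F K 1
  have hy' : ∑ τ : Gal(K/F), τ y = 1 := by
    rw [← trace_eq_sum_automorphisms, hy, map_one]
  refine ⟨-∑ τ, f τ * τ y, fun σ => ?_⟩
  have e1 : ∑ τ, f τ * τ y = ∑ τ, f (σ * τ) * (σ * τ) y :=
    (Fintype.sum_equiv (Equiv.mulLeft σ) _ _ (fun _ => rfl)).symm
  have e2 : f σ = ∑ τ, f σ * (σ * τ) y := by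
    have h : ∑ τ, (σ * τ) y = 1 :=
      (Fintype.sum_equiv (Equiv.mulLeft σ) _ _ (fun _ => rfl)).trans hy'
    rw [← Finset.mul_sum, h, mul_one]
  have h : σ (∑ τ, f τ * τ y) = ∑ τ, f τ * τ y - f σ := by
    rw [eq_sub_iff_add_eq]
    conv_rhs => rw [e1]
    refine (congrArg (_ + ·) e2).trans ?_
    rw [map_sum]
    rw [← Finset.sum_add_distrib]
    refine Finset.sum_congr rfl fun τ _ => ?_
    simp only [hf, AlgEquiv.mul_apply, map_mul]
    ring
  rw [map_neg, h]
  ring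

/-- An integer-valued 2-cocycle becomes a coboundary in the additive group of a Galois extension,
again by averaging against an element of trace one. -/
theorem exists_additive_cochain {K : Type*} [Field K] [Algebra F K]
    [FiniteDimensional F K] [IsGalois F K] (f : Gal(K/F) → Gal(K/F) → ℤ)
    (hf : ∀ ρ σ τ, f σ τ + f ρ (σ * τ) = f (ρ * σ) τ + f ρ σ) (h1 : ∀ τ, f 1 τ = 0) :
    ∃ b : Gal(K/F) → K, b 1 = 0 ∧ ∀ σ τ, b σ + σ (b τ) = b (σ * τ) + f σ τ := by
  obtain ⟨y, hy⟩ := Algebra.trace_surjective F K 1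
  have hy' : ∑ τ : Gal(K/F), τ y = 1 := by
    rw [← trace_eq_sum_automorphisms, hy, map_one]
  refine ⟨fun σ => ∑ τ, (f σ τ : K) * (σ * τ) y, by simp [h1], fun σ τ => ?_⟩
  have e1 : ∑ ρ, (f σ ρ : K) * (σ * ρ) y = ∑ ρ, (f σ (τ * ρ) : K) * (σ * (τ * ρ)) y :=
    (Fintype.sum_equiv (Equiv.mulLeft τ) _ _ (fun _ => rfl)).symm
  have e2 : (f σ τ : K) = ∑ ρ, (f σ τ : K) * (σ * (τ * ρ)) y := by
    rw [← Finset.mul_sum]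
    have : ∑ ρ, (σ * (τ * ρ)) y = 1 := by
      rw [← hy']
      exact Fintype.sum_equiv (Equiv.mulLeft (σ * τ)) _ _ (fun ρ => by simp)
    rw [this, mul_one]
  change ∑ ρ, (f σ ρ : K) * (σ * ρ) y + σ (∑ ρ, (f τ ρ : K) * (τ * ρ) y) =
    ∑ ρ, (f (σ * τ) ρ : K) * (σ * τ * ρ) y + _
  rw [e1, e2, map_sum, ← Finset.sum_add_distrib, ← Finset.sum_add_distrib]
  refine Finset.sum_congr rfl fun ρ _ => ?_
  have h := congrArg (Int.cast : ℤ → K) (hf σ τ ρ)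
  push_cast at h
  simp only [map_mul, map_intCast, ← AlgEquiv.mul_apply, mul_assoc] at h ⊢
  linear_combination ((σ * (τ * ρ)) y) * h

variable {p : ℕ} [Fact p.Prime]

theorem exists_artinSchreier_root [IsAlgClosed E] (a : E) : ∃ θ : E, θ ^ p - θ = a := by
  have hp : 1 < p := (Fact.out : p.Prime).one_lt
  have hdeg : (Polynomial.X ^ p - (Polynomial.X + Polynomial.C a) : Polynomial E).natDegree = p :=
    (Polynomial.natDegree_sub_eq_left_of_natDegree_lt (by
      rwa [Polynomial.natDegree_X_add_C, Polynomial.natDegree_X_pow])).trans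
      (Polynomial.natDegree_X_pow p)
  obtain ⟨θ, hθ⟩ := IsAlgClosed.exists_root
    (Polynomial.X ^ p - (Polynomial.X + Polynomial.C a) : Polynomial E) fun h => by
      rw [Polynomial.degree_eq_natDegree (fun h0 => by simp [h0] at hdeg; omega), hdeg] at h
      exact (Fact.out : p.Prime).ne_zero (by exact_mod_cast h)
  refine ⟨θ, ?_⟩
  simp only [Polynomial.IsRoot, Polynomial.eval_sub, Polynomial.eval_pow, Polynomial.eval_X,
    Polynomial.eval_add, Polynomial.eval_C] at hθ
  linear_combination hθ

/-- Characters killed by the characteristic are Artin–Schreier characters. -/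
theorem exists_artinSchreier_generator [IsGalois F E] [CharP E p]
    (χ : characterGroup Gal(E/F)) (hχ : p • χ = 0) :
    ∃ θ : E, ∀ σ : Gal(E/F), ∃ a : ZMod p, RatModInt.ofZMod p a = χ.1 σ ∧
      σ θ = θ + ZMod.castHom (dvd_refl p) E a := by
  obtain ⟨K, _, _, c, hc, hcχ⟩ :=
    characterGroup.exists_zmod χ (Fact.out : p.Prime).pos hχ
  have : CharP K p := (algebraMap K E).charP (FaithfulSMul.algebraMap_injective K E) p
  obtain ⟨θ, hθ⟩ := exists_eq_sub_of_additive_cocycle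
    (fun s : Gal(K/F) => ZMod.castHom (dvd_refl p) K (c s)) fun s t => by
      obtain ⟨k, hk⟩ := ZMod.intCast_surjective (c t)
      rw [hc, map_add, ← hk]
      simp
  refine ⟨θ, fun σ => ⟨c (AlgEquiv.restrictNormalHom K σ),
    hcχ _ _ fun x => AlgEquiv.restrictNormal_commutes σ K x, ?_⟩⟩
  have h := congrArg (Subtype.val : K → E) (hθ (AlgEquiv.restrictNormalHom K σ))
  have h2 := AlgEquiv.restrictNormal_commutes σ K θ
  obtain ⟨k, hk⟩ := ZMod.intCast_surjective (c (AlgEquiv.restrictNormalHom K σ))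
  rw [← hk] at h ⊢
  rw [map_intCast] at h ⊢
  have h3 : (((AlgEquiv.restrictNormalHom K σ) θ : K) : E) - θ = (k : E) := by simpa using h
  rw [← h3, add_sub_cancel]
  exact h2.symm

/-- The Artin–Schreier character attached to a root `θ` of `X ^ p - X - a` with `a ∈ F`. -/
theorem exists_artinSchreier_character [IsGalois F E] [CharP E p] {θ : E}
    (hθ : ∀ σ : Gal(E/F), σ (θ ^ p - θ) = θ ^ p - θ) :
    ∃ χ : characterGroup Gal(E/F), p • χ = 0 ∧ ∀ σ : Gal(E/F), ∃ a : ZMod p,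
      RatModInt.ofZMod p a = χ.1 σ ∧ σ θ = θ + ZMod.castHom (dvd_refl p) E a := by
  have h : ∀ σ : Gal(E/F), ∃ a : ZMod p, σ θ = θ + ZMod.castHom (dvd_refl p) E a := by
    intro σ
    obtain ⟨a, ha⟩ := ZMod.exists_castHom_eq_of_pow_eq_self (p := p) (x := σ θ - θ) (by
      have := hθ σ
      rw [map_sub, map_pow] at this
      rw [sub_pow_char]
      linear_combination this)
    exact ⟨a, by rw [ha]; ring⟩
  choose d hd using h
  have hinj : ∀ a b : ZMod p, θ + ZMod.castHom (dvd_refl p) E a =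
      θ + ZMod.castHom (dvd_refl p) E b → a = b := fun a b hab =>
    (ZMod.castHom (dvd_refl p) E).injective (add_left_cancel hab)
  have := IntermediateField.adjoin.finiteDimensional (Algebra.IsIntegral.isIntegral (R := F) θ)
  refine ⟨⟨fun σ => RatModInt.ofZMod p (d σ), mem_characterGroup_of_fixingSubgroup
    (fun σ τ => ?_) (IntermediateField.adjoin F {θ}) fun σ hσ => ?_⟩, ?_, fun σ => ⟨d σ, rfl, hd σ⟩⟩
  · rw [← map_add]
    congr 1
    apply hinj
    obtain ⟨k, hk⟩ := ZMod.intCast_surjective (d τ)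
    rw [← hd, AlgEquiv.mul_apply, hd τ, map_add, hd σ, map_add, ← hk]
    simp
    ring
  · rw [show d σ = 0 from hinj _ _ ?_, map_zero]
    rw [← hd]
    have := hσ ⟨θ, IntermediateField.mem_adjoin_simple_self F θ⟩
    simpa using this
  · ext σ
    exact RatModInt.nsmul_ofZMod p (d σ)

/-- In characteristic `p` every character of order `p ^ n` is `p` times a character: a cyclic
extension of degree `p ^ n` embeds into one of degree `p ^ (n + 1)`. The obstruction is a 2-cocycle
with values in `𝔽_p`. It becomes a coboundary `b` in the additive group of the extension, the
Artin–Schreier operator turns `b` into a 1-cocycle, and the latter is trivial by Hilbert's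
Theorem 90. -/
theorem exists_nsmul_eq_of_charP [IsGalois F E] [IsAlgClosed E] [CharP E p] {n : ℕ}
    (χ : characterGroup Gal(E/F)) (hχ : p ^ n • χ = 0) : ∃ ψ, p • ψ = χ := by
  have hp : p.Prime := Fact.out
  have hn : 0 < p ^ n := pow_pos hp.pos n
  have : NeZero (p ^ n) := ⟨hn.ne'⟩
  obtain ⟨K, _, _, c, hc, hcχ⟩ := characterGroup.exists_zmod χ hn hχ
  have : CharP K p := (algebraMap K E).charP (FaithfulSMul.algebraMap_injective K E) p
  -- `C` lifts the character to `ℤ`, and `p ^ n * f` measures the failure of additivity of the lift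
  let C : Gal(K/F) → ℤ := fun s => ((c s).val : ℤ)
  have hCc : ∀ s, ((C s : ℤ) : ZMod (p ^ n)) = c s := fun s => by simp [C]
  have hc1 : c 1 = 0 := by
    have := hc 1 1
    rwa [mul_one, left_eq_add] at this
  have hC1 : C 1 = 0 := by simp [C, hc1]
  have hf : ∀ s t, ∃ f : ℤ, C s + C t - C (s * t) = (p ^ n : ℕ) * f := fun s t => by
    have : ((C s + C t - C (s * t) : ℤ) : ZMod (p ^ n)) = 0 := by
      push_cast
      rw [hCc, hCc, hCc, hc, sub_self]
    exact (ZMod.intCast_zmod_eq_zero_iff_dvd _ _).1 this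
  choose f hf using hf
  have hn' : ((p ^ n : ℕ) : ℤ) ≠ 0 := by exact_mod_cast hn.ne'
  obtain ⟨b, hb1, hb⟩ := exists_additive_cochain f
    (fun r s t => by
      apply mul_left_cancel₀ hn'
      rw [mul_add, mul_add, ← hf, ← hf, ← hf, ← hf, mul_assoc]
      ring)
    (fun t => by
      apply mul_left_cancel₀ hn'
      rw [← hf, hC1, one_mul]
      ring)
  have hint : ∀ k : ℤ, (k : K) ^ p = k := fun k => by
    rw [← map_intCast (ZMod.castHom (dvd_refl p) K), ← map_pow, ZMod.pow_card]
  obtain ⟨β, hβ⟩ := exists_eq_sub_of_additive_cocycle (fun s => b s ^ p - b s) fun s t => by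
    have h : b (s * t) = b s + s (b t) - f s t := by rw [hb]; ring
    rw [h, sub_pow_char, add_pow_char, hint, map_sub, map_pow]
    ring
  -- the coboundary `σ ↦ σ θ - θ` corrects `b` to a cochain `d` with values in the prime field
  obtain ⟨θ, hθ⟩ := exists_artinSchreier_root (p := p) (β : E)
  let r : Gal(E/F) → Gal(K/F) := fun σ => AlgEquiv.restrictNormalHom K σ
  have hr : ∀ σ x, ((r σ x : K) : E) = σ x := fun σ x => AlgEquiv.restrictNormal_commutes σ K x
  have hrmul : ∀ σ τ, r (σ * τ) = r σ * r τ := map_mul _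
  have hd : ∀ σ, ∃ d : ZMod p, ZMod.castHom (dvd_refl p) E d = (b (r σ) : E) - (σ θ - θ) := by
    intro σ
    apply ZMod.exists_castHom_eq_of_pow_eq_self
    have h1 : ((r σ β : K) : E) - β = (b (r σ) : E) ^ p - b (r σ) := by
      have := congrArg (Subtype.val : K → E) (hβ (r σ))
      simpa using this
    rw [hr, ← hθ, map_sub, map_pow] at h1
    rw [sub_pow_char, sub_pow_char]
    linear_combination -h1
  choose d hd using hd
  have hdf : ∀ σ τ, d σ + d τ - d (σ * τ) = (f (r σ) (r τ) : ZMod p) := by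
    intro σ τ
    apply (ZMod.castHom (dvd_refl p) E).injective
    obtain ⟨k, hk⟩ := ZMod.intCast_surjective (d τ)
    have h1 : σ (ZMod.castHom (dvd_refl p) E (d τ)) = ZMod.castHom (dvd_refl p) E (d τ) := by
      rw [← hk]; simp
    have h2 : (b (r σ) : E) + σ (b (r τ)) = b (r σ * r τ) + f (r σ) (r τ) := by
      rw [← hr]
      have := congrArg (Subtype.val : K → E) (hb (r σ) (r τ))
      simpa using this
    rw [map_sub, map_add, ← h1, hd, hd, hd, map_intCast, hrmul, AlgEquiv.mul_apply, map_sub,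
      map_sub]
    linear_combination h2
  -- `g` is additive modulo `p ^ (n + 1)` and congruent to `C` modulo `p ^ n`
  let g : Gal(E/F) → ℤ := fun σ => C (r σ) - (p ^ n : ℕ) * (d σ).val
  have hg : ∀ σ τ, ((g (σ * τ) : ℤ) : ZMod (p ^ n * p)) = (g σ + g τ : ℤ) := by
    intro σ τ
    rw [ZMod.intCast_eq_intCast_iff_dvd_sub]
    have h1 : (p : ℤ) ∣ f (r σ) (r τ) - ((d σ).val + (d τ).val - (d (σ * τ)).val) := by
      rw [← ZMod.intCast_zmod_eq_zero_iff_dvd]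
      push_cast
      simp only [ZMod.natCast_val, ZMod.cast_id', id]
      rw [hdf, sub_self]
    have h2 : g σ + g τ - g (σ * τ) = (p ^ n : ℕ) *
        (f (r σ) (r τ) - ((d σ).val + (d τ).val - (d (σ * τ)).val)) := by
      have := hf (r σ) (r τ)
      simp only [g, hrmul]
      linear_combination this
    rw [h2, Nat.cast_mul]
    exact mul_dvd_mul_left _ h1
  have hg0 : ∀ σ ∈ (K ⊔ IntermediateField.adjoin F {θ}).fixingSubgroup, g σ = 0 := by
    intro σ hσ
    have hr1 : r σ = 1 := by
      ext x
      rw [hr]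
      exact hσ ⟨x, (le_sup_left : K ≤ _) x.2⟩
    have hσθ : σ θ = θ := hσ ⟨θ, (le_sup_right : _ ≤ K ⊔ IntermediateField.adjoin F {θ})
      (IntermediateField.mem_adjoin_simple_self F θ)⟩
    have hd0 : d σ = 0 := by
      apply (ZMod.castHom (dvd_refl p) E).injective
      rw [hd, hr1, hb1, hσθ, map_zero]
      simp
    simp [g, hr1, hC1, hd0]
  have := IntermediateField.adjoin.finiteDimensional (Algebra.IsIntegral.isIntegral (R := F) θ)
  refine ⟨⟨fun σ => RatModInt.ofZMod (p ^ n * p) (g σ), mem_characterGroup_of_fixingSubgroup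
    (fun σ τ => by rw [hg, Int.cast_add, map_add]) (K ⊔ IntermediateField.adjoin F {θ})
    fun σ hσ => by rw [hg0 σ hσ]; simp⟩, ?_⟩
  ext σ
  have h1 := RatModInt.ofZMod_castHom (mul_pos hn hp.pos) (Dvd.intro p rfl) (g σ : ZMod (p ^ n * p))
  rw [Nat.mul_div_cancel_left _ hn, map_intCast] at h1
  refine h1.symm.trans ?_
  rw [← hcχ σ (r σ) (hr σ), ← hCc]
  congr 1
  have h0 : ((p ^ n : ℕ) : ZMod (p ^ n)) = 0 := ZMod.natCast_self _
  simp only [g, Int.cast_sub, Int.cast_mul, Int.cast_natCast, h0, zero_mul, sub_zero]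

open Cardinal in
/-- A character killed by the characteristic is determined by an Artin–Schreier generator. -/
theorem mk_torsionBy_characterGroup_le_of_charP [IsGalois F E] [CharP E p] :
    #(Submodule.torsionBy ℤ (characterGroup Gal(E/F)) p) ≤ #E := by
  have h : ∀ χ : Submodule.torsionBy ℤ (characterGroup Gal(E/F)) p, p • χ.1 = 0 := fun χ =>
    (natCast_zsmul _ _).symm.trans χ.2
  choose θ a ha using fun χ : Submodule.torsionBy ℤ (characterGroup Gal(E/F)) p =>
    exists_artinSchreier_generator χ.1 (h χ)
  refine mk_le_of_injective (f := θ) fun χ ψ hχψ => ?_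
  ext σ
  rw [← (ha χ σ).1, ← (ha ψ σ).1]
  congr 1
  apply (ZMod.castHom (dvd_refl p) E).injective
  apply add_left_cancel (a := θ χ)
  rw [← (ha χ σ).2, hχψ, (ha ψ σ).2]

/-- A family in `F` that is independent over `𝔽_p` modulo the image of `x ↦ x ^ p - x` has
independent Artin–Schreier characters. -/
theorem exists_isIndepMod_artinSchreier [IsGalois F E] [IsAlgClosed E] [CharP E p]
    {S : Type w} (a : S → F)
    (hind : ∀ (T : Finset S) (c : S → ℤ) (f : F), ∑ s ∈ T, c s * a s = f ^ p - f →
      ∀ s ∈ T, (p : ℤ) ∣ c s) :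
    ∃ χ : S → characterGroup Gal(E/F), (∀ s, (p : ℤ) • χ s = 0) ∧ IsIndepMod p χ := by
  have hp : p.Prime := Fact.out
  choose θ hθ using fun s => exists_artinSchreier_root (p := p) (algebraMap F E (a s))
  choose χ hχ d hd using fun s => exists_artinSchreier_character (p := p) (θ := θ s)
    (F := F) fun σ => by rw [hθ, AlgEquiv.commutes]
  refine ⟨χ, fun s => (natCast_zsmul _ _).trans (hχ s), fun T c hc s hs => ?_⟩
  have hsum : ∀ σ, ∑ s ∈ T, (c s : ZMod p) * d s σ = 0 := by
    intro σ
    have := congrFun (congrArg Subtype.val hc) σ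
    rw [AddSubgroup.val_finsetSum, Finset.sum_apply] at this
    apply RatModInt.ofZMod_injective hp.pos
    rw [map_zero]
    refine Eq.trans ?_ this
    rw [map_sum]
    refine Finset.sum_congr rfl fun s _ => ?_
    change _ = c s • (χ s).1 σ
    rw [← (hd s σ).1, ← map_zsmul, zsmul_eq_mul]
  have hint : ∀ k : ℤ, (k : E) ^ p = k := fun k => by
    rw [← map_intCast (ZMod.castHom (dvd_refl p) E), ← map_pow, ZMod.pow_card]
  -- a relation between the characters makes the combination of the roots Galois invariant
  obtain ⟨f, hf⟩ := (InfiniteGalois.mem_range_algebraMap_iff_fixed (k := F)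
    (∑ s ∈ T, (c s : E) * θ s)).2 fun σ => by
      rw [map_sum]
      simp only [map_mul, map_intCast, (hd _ σ).2, mul_add, Finset.sum_add_distrib]
      have := congrArg (ZMod.castHom (dvd_refl p) E) (hsum σ)
      simp only [map_sum, map_mul, map_intCast, map_zero] at this
      rw [this, add_zero]
  refine hind T c f ?_ s hs
  apply FaithfulSMul.algebraMap_injective F E
  rw [map_sub, map_pow, hf, sum_pow_char, ← Finset.sum_sub_distrib, map_sum]
  refine Finset.sum_congr rfl fun s _ => ?_
  rw [mul_pow, hint, ← mul_sub, hθ, map_mul, map_intCast]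

end ArtinSchreier

/-! ### Hensel's lemma for power series -/

section Hensel

open Polynomial in
/-- Hensel's lemma: a monic polynomial over `K⟦X⟧`, `K` algebraically closed, with separable
reduction has all its roots in `K⟦X⟧`. -/
theorem mem_range_of_separable_reduction {K W : Type*} [Field K] [IsAlgClosed K] [Field W]
    {f : (PowerSeries K)[X]} (hf : f.Monic)
    (hsep : (f.map (PowerSeries.constantCoeff (R := K))).Separable)
    {j : PowerSeries K →+* W} (hj : Function.Injective j) {w : W} (hw : f.eval₂ j w = 0) :
    w ∈ j.range := by
  classical
  set g := f.map (PowerSeries.constantCoeff (R := K)) with hg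
  have hlift : ∀ a ∈ g.roots.toFinset, ∃ r : PowerSeries K, f.IsRoot r ∧
      PowerSeries.constantCoeff r = a := by
    intro a ha
    have hga : g.IsRoot a := by
      rw [Multiset.mem_toFinset] at ha
      exact isRoot_of_mem_roots ha
    have hev : ∀ h : (PowerSeries K)[X], PowerSeries.constantCoeff (h.eval (PowerSeries.C a)) =
        (h.map (PowerSeries.constantCoeff (R := K))).eval a := fun h => by
      have := eval₂_at_apply (p := h) (PowerSeries.constantCoeff (R := K)) (PowerSeries.C a)
      rw [PowerSeries.constantCoeff_C] at this
      rw [eval_map, this]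
    obtain ⟨r, hr, hra⟩ := HenselianRing.is_henselian
      (I := Ideal.span {(PowerSeries.X : PowerSeries K)}) f hf (PowerSeries.C a) (by
        rw [Ideal.mem_span_singleton, PowerSeries.X_dvd_iff, hev]
        exact hga) (by
        have h1 : (derivative g).eval a ≠ 0 := hsep.eval₂_derivative_ne_zero (RingHom.id K) hga
        rw [hg, derivative_map, ← hev] at h1
        exact (PowerSeries.isUnit_iff_constantCoeff.2 (Ne.isUnit h1)).map _)
    refine ⟨r, hr, ?_⟩
    rw [Ideal.mem_span_singleton, PowerSeries.X_dvd_iff, map_sub, sub_eq_zero] at hra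
    simpa using hra
  choose! r hr hra using hlift
  -- the lifted roots are as many as the degree allows, so there are no other roots in `W`
  have hgcard : g.roots.toFinset.card = f.natDegree := by
    rw [Multiset.toFinset_card_of_nodup (nodup_roots hsep),
      ← (IsAlgClosed.splits g).natDegree_eq_card_roots, hf.natDegree_map]
  have hsub : g.roots.toFinset.image (fun a => j (r a)) ⊆ (f.map j).roots.toFinset := by
    intro x hx
    obtain ⟨a, ha, rfl⟩ := Finset.mem_image.1 hx
    rw [Multiset.mem_toFinset, mem_roots (hf.map j).ne_zero]
    exact (hr a ha).map
  have hcard : (g.roots.toFinset.image (fun a => j (r a))).card = f.natDegree := by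
    rw [Finset.card_image_of_injOn, hgcard]
    intro a ha b hb hab
    rw [← hra a ha, ← hra b hb, hj hab]
  have heq := Finset.eq_of_subset_of_card_le hsub (by
    rw [hcard, ← hf.natDegree_map j]
    exact (Multiset.toFinset_card_le _).trans (card_roots' _))
  have hmem : w ∈ (f.map j).roots.toFinset := by
    rw [Multiset.mem_toFinset, mem_roots (hf.map j).ne_zero, IsRoot, eval_map, hw]
  rw [← heq] at hmem
  obtain ⟨a, -, rfl⟩ := Finset.mem_image.1 hmem
  exact ⟨_, rfl⟩

end Hensel

theorem exists_isSeparable_pow {F E : Type*} [Field F] [Field E] [Algebra F E] (q : ℕ)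
    [ExpChar F q] {x : E} (hx : IsAlgebraic F x) : ∃ n : ℕ, IsSeparable F (x ^ q ^ n) := by
  obtain ⟨n, y, hy⟩ := IsPurelyInseparable.pow_mem (separableClosure F (algebraicClosure F E)) q
    (⟨x, mem_algebraicClosure_iff.2 hx⟩ : algebraicClosure F E)
  have h1 := (mem_separableClosure_iff.1 y.2).map (algebraicClosure F E).val Subtype.val_injective
  have h2 : (algebraicClosure F E).val y = x ^ q ^ n := congrArg (algebraicClosure F E).val hy
  exact ⟨n, h2 ▸ h1⟩

/-! ### Embeddings into Laurent series -/

section Embedding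

open Polynomial

/-- Taylor expansion of polynomials at `-m`, viewed as power series: the substitution
`t ↦ X - m`. -/
noncomputable def shiftHom {R K : Type*} [CommRing R] [Field K] (f : R →+* K) (m : K) :
    R[X] →+* PowerSeries K :=
  eval₂RingHom ((PowerSeries.C (R := K)).comp f) (PowerSeries.X - PowerSeries.C m)

theorem shiftHom_eq {R K : Type*} [CommRing R] [Field K] (f : R →+* K) (m : K) (p : R[X]) :
    shiftHom f m p = (taylor (-m) (p.map f) : K[X]) := by
  induction p using Polynomial.induction_on' with
  | add p q hp hq => simp [hp, hq]
  | monomial n a => simp [shiftHom, sub_eq_add_neg]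

theorem shiftHom_injective {R K : Type*} [CommRing R] [Field K] {f : R →+* K}
    (hf : Function.Injective f) (m : K) : Function.Injective (shiftHom f m) := by
  intro p q h
  rw [shiftHom_eq, shiftHom_eq] at h
  exact map_injective f hf (taylor_injective _ (Polynomial.coe_injective K h))

theorem constantCoeff_shiftHom {R K : Type*} [CommRing R] [Field K] (f : R →+* K) (m : K)
    (p : R[X]) : PowerSeries.constantCoeff (shiftHom f m p) = p.eval₂ f (-m) := by
  rw [shiftHom_eq]
  simp [eval_map]

theorem exists_ringHom_algebraicClosure {A Ω W : Type*} [Field A] [Field Ω] [Algebra A Ω]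
    [Field W] [IsAlgClosed W] (φ : A →+* W) :
    ∃ J : algebraicClosure A Ω →+* W, ∀ a, J (algebraMap A (algebraicClosure A Ω) a) = φ a := by
  let _ : Algebra A W := φ.toAlgebra
  exact ⟨(IsAlgClosed.lift : algebraicClosure A Ω →ₐ[A] W).toRingHom, AlgHom.commutes _⟩

/-- Let `t` be transcendental over `B` and let `m ∈ B` be transcendental over `D`. Up to purely
inseparable elements, every field generated over `B` by elements algebraic over `D(t)` embeds into
a field of Laurent series over an extension of `B`, such that `t + m` becomes the uniformizer. -/
theorem exists_laurentSeries_embedding {Ω : Type u} [Field Ω] (q : ℕ) [ExpChar Ω q]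
    {D B : Subfield Ω} (hDB : D ≤ B) {t : Ω} (ht : Transcendental B t) {m : B}
    (hm : Transcendental D (m : Ω)) {L N : Subfield Ω}
    (hL : ∀ x ∈ L, IsAlgebraic (IntermediateField.adjoin D {t}) x) (hN : N ≤ L ⊔ B) :
    ∃ (K W : Type u) (_ : Field K) (_ : Field W) (i : B →+* K) (j : LaurentSeries K →+* W)
      (J : N →+* W),
      (∀ (x : N) (a : B), (x : Ω) = t + a → J x =
        j ((PowerSeries.X + PowerSeries.C (i a - i m) : PowerSeries K) : LaurentSeries K)) ∧
      ∀ x : N, ∃ n : ℕ, J x ^ q ^ n ∈ j.range := by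
  let K := AlgebraicClosure B
  let i : B →+* K := algebraMap B K
  let Λ := LaurentSeries K
  let W := AlgebraicClosure Λ
  let j : Λ →+* W := algebraMap Λ W
  let c : PowerSeries K →+* Λ := HahnSeries.ofPowerSeries ℤ K
  have hc : Function.Injective c := HahnSeries.ofPowerSeries_injective
  have hjc : Function.Injective (j.comp c) := j.injective.comp hc
  let e : B[X] →+* PowerSeries K := shiftHom i (i m)
  have he : Function.Injective e := shiftHom_injective i.injective _
  let BT := IntermediateField.adjoin B {t}
  let DT := IntermediateField.adjoin D {t}
  have hce : nonZeroDivisors B[X] ≤ (nonZeroDivisors Λ).comap (c.comp e) :=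
    nonZeroDivisors_le_comap_nonZeroDivisors_of_injective (c.comp e) (hc.comp he)
  let jB : BT →+* Λ := (RatFunc.liftRingHom (c.comp e) hce).comp
    (RatFunc.algEquivOfTranscendental t ht).symm.toRingEquiv.toRingHom
  have hjB : ∀ (p : B[X]) (x : BT), (x : Ω) = aeval t p → jB x = c (e p) := by
    intro p x hx
    have : x = RatFunc.algEquivOfTranscendental t ht (algebraMap _ _ p) := by
      rw [RatFunc.algEquivOfTranscendental_algebraMap]
      ext
      rw [hx]
      simp
    change RatFunc.liftRingHom (c.comp e) hce ((RatFunc.algEquivOfTranscendental t ht).symm x) = _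
    rw [this, AlgEquiv.symm_apply_apply, RatFunc.liftRingHom_algebraMap]
    rfl
  let E := algebraicClosure BT Ω
  obtain ⟨J, hJB⟩ : ∃ J : E →+* W, ∀ a, J (algebraMap BT E a) = j (jB a) :=
    exists_ringHom_algebraicClosure (j.comp jB)
  have hJ : ∀ (p : B[X]) (x : E), (x : Ω) = aeval t p → J x = j (c (e p)) := by
    intro p x hx
    have hmem : aeval t p ∈ BT := by
      have := (aeval (IntermediateField.AdjoinSimple.gen B t) p).2
      simpa using this
    have h1 : x = algebraMap BT E ⟨aeval t p, hmem⟩ := Subtype.ext hx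
    rw [h1, hJB, ← hjB p ⟨_, hmem⟩ rfl]
  have hDTBT : DT.toSubfield ≤ BT.toSubfield := by
    rw [IntermediateField.adjoin_toSubfield, Subfield.closure_le]
    rintro x (⟨d, rfl⟩ | hx)
    · exact BT.algebraMap_mem ⟨d, hDB d.2⟩
    · exact IntermediateField.subset_adjoin B {t} hx
  have hLE : ∀ x ∈ L, x ∈ E := by
    intro x hx
    let _ : Algebra DT BT := (Subfield.inclusion hDTBT).toAlgebra
    have : IsScalarTower DT BT Ω := .of_algebraMap_eq fun _ => rfl
    exact mem_algebraicClosure_iff.2 ((hL x hx).tower_top BT)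
  have hBE : ∀ x ∈ B, x ∈ E := fun x hx =>
    E.algebraMap_mem ⟨x, BT.algebraMap_mem ⟨x, hx⟩⟩
  have hNE : N ≤ E.toSubfield := hN.trans (sup_le hLE hBE)
  have hcharΛ : ExpChar Λ q := by
    have h1 : ExpChar B q := B.subtype.expChar B.subtype.injective q
    exact expChar_of_injective_ringHom ((c.comp e).comp C).injective q
  -- Elements of `D(t)` go to power series, because `-m` is not a zero of a polynomial over `D`.
  have hD : ∀ d : DT, ∃ s : PowerSeries K, j (c s) = J ⟨d, E.algebraMap_mem ⟨d, hDTBT d.2⟩⟩ := by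
    rintro ⟨d, hd⟩
    obtain ⟨r, s, hrs⟩ := (IntermediateField.mem_adjoin_simple_iff D d).1 hd
    let inc : D →+* B := Subfield.inclusion hDB
    have hmap : ∀ p : D[X], aeval t (p.map inc) = aeval t p := fun p => by
      rw [aeval_def, eval₂_map]
      rfl
    have hmemE : ∀ p : D[X], aeval t p ∈ E := fun p => by
      rw [← hmap]
      exact E.algebraMap_mem ⟨aeval t (p.map inc), (IntermediateField.mem_adjoin_simple_iff B _).2
        ⟨p.map inc, 1, by simp⟩⟩
    by_cases hs : s = 0
    · refine ⟨0, ?_⟩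
      rw [map_zero, map_zero, eq_comm, map_eq_zero]
      ext
      simp [hrs, hs]
    have hs0 : PowerSeries.constantCoeff (e (s.map inc)) ≠ 0 := by
      rw [constantCoeff_shiftHom, eval₂_map]
      intro h0
      have h1 : aeval (-(m : Ω)) s = 0 := by
        have h2 : i (s.eval₂ inc (-m)) = 0 := by
          rw [hom_eval₂, map_neg, h0]
        have h3 := congrArg B.subtype ((map_eq_zero i).1 h2)
        rw [hom_eval₂, map_zero, map_neg] at h3
        exact h3
      refine hm ?_
      have h4 : IsAlgebraic D (-(m : Ω)) := ⟨s, hs, h1⟩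
      simpa using h4.neg
    refine ⟨e (r.map inc) * (e (s.map inc))⁻¹, ?_⟩
    have h5 : (⟨d, E.algebraMap_mem ⟨d, hDTBT hd⟩⟩ : E) =
        ⟨aeval t r, hmemE r⟩ / ⟨aeval t s, hmemE s⟩ := Subtype.ext hrs
    rw [h5, map_div₀, hJ (r.map inc) _ (hmap r).symm, hJ (s.map inc) _ (hmap s).symm, eq_div_iff]
    · rw [← map_mul, ← map_mul, mul_assoc, PowerSeries.inv_mul_cancel _ hs0, mul_one]
    · rw [_root_.map_ne_zero, map_ne_zero_iff c hc]
      rintro h0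
      simp [h0] at hs0
  -- The elements with a `q ^ n`-th power in the range of `j` form a subfield, so only generators
  -- matter. A separable element of `L` has a separable minimal polynomial over `D(t)`, whose image
  -- under `t ↦ X - m` has a reduction that is still separable: Hensel's lemma applies.
  have key : ∀ x : E, (x : Ω) ∈ L ⊔ B → ∃ n : ℕ, J x ^ q ^ n ∈ j.range := by
    let R : Subfield Ω := ((perfectClosure Λ W).toSubfield.comap J).map E.val.toRingHom
    have hR : ∀ x : E, (∃ n : ℕ, J x ^ q ^ n ∈ j.range) → (x : Ω) ∈ R := fun x hx =>
      ⟨x, (mem_perfectClosure_iff_pow_mem q).2 hx, rfl⟩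
    have hR' : L ⊔ B ≤ R := by
      refine sup_le (fun x hx => hR ⟨x, hLE x hx⟩ ?_) fun x hx => hR ⟨x, hBE x hx⟩ ⟨0, ?_⟩
      · have hcD : ExpChar DT q := (algebraMap DT Ω).expChar (algebraMap DT Ω).injective q
        obtain ⟨n, hn⟩ := exists_isSeparable_pow q (hL x hx)
        refine ⟨n, ?_⟩
        have hDE : DT.toSubfield ≤ E.toSubfield := fun d hd => E.algebraMap_mem ⟨d, hDTBT hd⟩
        let inc : DT →+* E := Subfield.inclusion hDE
        let δ₀ : DT →+* W := J.comp inc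
        have hδ₀ : ∀ d, δ₀ d ∈ (j.comp c).range := fun d => hD d
        let eq : PowerSeries K ≃+* (j.comp c).range := RingEquiv.ofBijective
          (j.comp c).rangeRestrict ⟨fun a b h => hjc (congrArg Subtype.val h),
            (j.comp c).rangeRestrict_surjective⟩
        let δ : DT →+* PowerSeries K := eq.symm.toRingHom.comp (δ₀.codRestrict _ hδ₀)
        have hδ : (j.comp c).comp δ = δ₀ := by
          ext d
          exact congrArg Subtype.val (eq.apply_symm_apply (δ₀.codRestrict _ hδ₀ d))
        have hint : IsIntegral DT (x ^ q ^ n) := hn.isIntegral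
        have hroot : ((minpoly DT (x ^ q ^ n)).map δ).eval₂ (j.comp c)
            (J ⟨x, hLE x hx⟩ ^ q ^ n) = 0 := by
          rw [eval₂_map, hδ, ← map_pow, ← hom_eval₂, map_eq_zero]
          apply Subtype.ext
          have h1 := minpoly.aeval DT (x ^ q ^ n)
          have h2 := hom_eval₂ (minpoly DT (x ^ q ^ n)) inc E.val.toRingHom
            (⟨x, hLE x hx⟩ ^ q ^ n)
          exact h2.trans h1
        obtain ⟨s, hs⟩ := mem_range_of_separable_reduction ((minpoly.monic hint).map δ)
          (by rw [Polynomial.map_map]; exact Separable.map hn) hjc hroot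
        exact ⟨c s, hs⟩
      · refine ⟨c (e (C ⟨x, hx⟩)), ?_⟩
        rw [pow_zero, pow_one, hJ (C ⟨x, hx⟩)]
        simp
        rfl
    intro x hx
    obtain ⟨y, hy, hyx⟩ := hR' hx
    obtain rfl : y = x := Subtype.ext hyx
    exact (mem_perfectClosure_iff_pow_mem q).1 hy
  refine ⟨K, W, inferInstance, inferInstance, i, j,
    J.comp (Subfield.inclusion hNE), fun x a hx => ?_, fun x => key _ (hN x.2)⟩
  refine (hJ (X + C a) _ (by rw [map_add, aeval_X, aeval_C]; exact hx)).trans ?_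
  congr 2
  simp [e, shiftHom]
  ring

end Embedding

/-! ### Independence by orders of vanishing -/

section Places

/-- Every member `a s₀` of the family `a` becomes a uniformizer, and all other members units, under
some embedding of `N`, up to purely inseparable elements, into a field of Laurent series. -/
def HasUniformizingEmbeddings {N : Type u} [Field N] {S : Type v} (q : ℕ) (a : S → N) : Prop :=
  ∀ s₀ : S, ∃ (K W : Type u) (_ : Field K) (_ : Field W) (j : LaurentSeries K →+* W)
    (J : N →+* W) (b : S → K), b s₀ = 0 ∧ (∀ s, s ≠ s₀ → b s ≠ 0) ∧
    (∀ s, J (a s) =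
      j ((PowerSeries.X + PowerSeries.C (b s) : PowerSeries K) : LaurentSeries K)) ∧
    ∀ x : N, ∃ n : ℕ, J x ^ q ^ n ∈ j.range

/-- The order of vanishing, as a homomorphism on the multiplicative group of Laurent series. -/
noncomputable def laurentOrderHom (K : Type*) [Field K] :
    (LaurentSeries K)ˣ →* Multiplicative ℤ :=
  MonoidHom.mk' (fun u => Multiplicative.ofAdd (HahnSeries.order (u : LaurentSeries K)))
    fun u v => by
      rw [Units.val_mul, HahnSeries.order_mul u.ne_zero v.ne_zero, ofAdd_add]

theorem order_X_add_C_zero {K : Type*} [Field K] :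
    HahnSeries.order ((PowerSeries.X + PowerSeries.C 0 : PowerSeries K) : LaurentSeries K) = 1 := by
  rw [map_zero, add_zero, PowerSeries.coe_X, HahnSeries.order_single one_ne_zero]

theorem order_coe_of_constantCoeff_ne_zero {K : Type*} [Field K] {f : PowerSeries K}
    (hf : PowerSeries.constantCoeff f ≠ 0) : HahnSeries.order (f : LaurentSeries K) = 0 := by
  have hc : (f : LaurentSeries K).coeff 0 ≠ 0 := by
    rw [PowerSeries.coeff_coe]
    simpa using hf
  refine le_antisymm (HahnSeries.order_le_of_coeff_ne_zero hc) ?_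
  by_contra! h
  have h0 : (f : LaurentSeries K) ≠ 0 := fun h0 => by simp [h0] at hc
  refine h0 (HahnSeries.coeff_order_eq_zero.1 ?_)
  rw [PowerSeries.coeff_coe, if_pos h]

theorem X_add_C_ne_zero {K : Type*} [Field K] (b : K) :
    ((PowerSeries.X + PowerSeries.C b : PowerSeries K) : LaurentSeries K) ≠ 0 := by
  intro h
  have := congrArg (HahnSeries.coeff · 1) h
  simp only [PowerSeries.coeff_coe] at this
  simp at this

variable {N : Type u} [Field N] {S : Type v} {q : ℕ} {a : S → N}

/-- Elements with uniformizing embeddings are independent modulo `ℓ`-th powers: under the embedding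
for `s₀`, the order of vanishing of a product of powers of the `a s` is the exponent of `a s₀`. -/
theorem HasUniformizingEmbeddings.dvd_of_prod_eq_pow (h : HasUniformizingEmbeddings q a) {ℓ : ℕ}
    (hℓ₀ : ℓ ≠ 0) (hℓ : ℓ.Coprime q) (T : Finset S) (c : S → ℤ) (f : N)
    (hf : ∏ s ∈ T, a s ^ c s = f ^ ℓ) :
    ∀ s ∈ T, (ℓ : ℤ) ∣ c s := by
  classical
  intro s₀ hs₀
  obtain ⟨K, W, _, _, j, J, b, hb0, hb, hJ, hpow⟩ := h s₀
  obtain ⟨n, g, hg⟩ := hpow f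
  let x : S → (LaurentSeries K)ˣ := fun s => Units.mk0 _ (X_add_C_ne_zero (b s))
  have hjx : ∀ s, j (x s) = J (a s) := fun s => (hJ s).symm
  have h1 : j (((∏ s ∈ T, x s ^ c s) ^ q ^ n : (LaurentSeries K)ˣ) : LaurentSeries K) =
      j (g ^ ℓ) := by
    rw [map_pow, hg, ← pow_mul, mul_comm, pow_mul, ← map_pow, ← hf]
    simp [hjx]
  have h2 := j.injective h1
  have hg0 : g ≠ 0 := by
    rintro rfl
    rw [zero_pow hℓ₀] at h2
    exact Units.ne_zero _ h2
  have h3 : (∏ s ∈ T, x s ^ c s) ^ q ^ n = (Units.mk0 g hg0) ^ ℓ := Units.ext (by simpa using h2)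
  have h4 := congrArg (fun u => (laurentOrderHom K u).toAdd) h3
  have h5 : ∀ s, (laurentOrderHom K (x s)).toAdd = if s = s₀ then 1 else 0 := by
    intro s
    change HahnSeries.order (x s : LaurentSeries K) = _
    split_ifs with hs
    · rw [hs, Units.val_mk0, hb0, order_X_add_C_zero]
    · exact order_coe_of_constantCoeff_ne_zero (by simpa using hb s hs)
  simp only [map_pow, map_prod, map_zpow, toAdd_pow, toAdd_prod, toAdd_zpow, h5, smul_ite,
    smul_zero, Finset.sum_ite_eq', hs₀, if_true, nsmul_eq_mul, zsmul_eq_mul, Int.cast_id,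
    mul_one] at h4
  have h6 : IsCoprime (ℓ : ℤ) ((q ^ n : ℕ) : ℤ) := Nat.isCoprime_iff_coprime.2 (hℓ.pow_right n)
  exact h6.dvd_of_dvd_mul_left ⟨_, h4⟩

/-- Since `h ^ p` and `h` are congruent modulo the image of `x ↦ x ^ p - x`, an element with a
`p ^ n`-th power in this image lies in the image. -/
theorem exists_sub_eq_of_pow_pow_eq {K : Type*} [Field K] {p : ℕ} [Fact p.Prime] [CharP K p]
    {h g : K} {n : ℕ} (hg : h ^ p ^ n = g ^ p - g) : ∃ g' : K, h = g' ^ p - g' := by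
  induction n generalizing g with
  | zero => exact ⟨g, by simpa using hg⟩
  | succ n ih =>
    refine ih (g := g - h ^ p ^ n) ?_
    rw [sub_pow_char, ← pow_mul, ← pow_succ, hg]
    ring

/-- The inverses of elements with uniformizing embeddings are independent modulo the image of
`x ↦ x ^ p - x`, since they have simple poles. -/
theorem HasUniformizingEmbeddings.dvd_of_sum_eq_sub {p : ℕ} [Fact p.Prime] [CharP N p]
    (h : HasUniformizingEmbeddings p a) (T : Finset S) (c : S → ℤ) (f : N)
    (hf : ∑ s ∈ T, c s * (a s)⁻¹ = f ^ p - f) : ∀ s ∈ T, (p : ℤ) ∣ c s := by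
  classical
  intro s₀ hs₀
  obtain ⟨K, W, _, _, j, J, b, hb0, hb, hJ, hpow⟩ := h s₀
  obtain ⟨n, g, hg⟩ := hpow f
  have : CharP W p := charP_of_injective_ringHom J.injective p
  have : CharP (LaurentSeries K) p := j.charP j.injective p
  have : CharP K p := (HahnSeries.C : K →+* LaurentSeries K).charP (RingHom.injective _) p
  let x : S → LaurentSeries K := fun s =>
    ((PowerSeries.X + PowerSeries.C (b s) : PowerSeries K) : LaurentSeries K)
  have hjx : ∀ s, j (x s) = J (a s) := fun s => (hJ s).symm
  let y : LaurentSeries K := ∑ s ∈ T, c s * (x s)⁻¹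
  have hjy : j y = J f ^ p - J f := by
    rw [← map_pow, ← map_sub, ← hf]
    simp [y, hjx]
  have hy : y ^ p ^ n = g ^ p - g := by
    apply j.injective
    rw [map_pow, hjy, sub_pow_char_pow, map_sub, map_pow, hg, ← pow_mul, ← pow_mul, mul_comm]
  obtain ⟨g, hg⟩ := exists_sub_eq_of_pow_pow_eq hy
  have hy1 : ∀ s, s ≠ s₀ → ∀ k < 0, ((x s)⁻¹).coeff k = 0 := by
    intro s hs k hk
    have hxs : HahnSeries.order (x s) = 0 :=
      order_coe_of_constantCoeff_ne_zero (by simpa using hb s hs)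
    have h1 : HahnSeries.order (x s)⁻¹ = 0 := by
      have h2 := HahnSeries.order_mul (X_add_C_ne_zero (b s)) (inv_ne_zero (X_add_C_ne_zero (b s)))
      rw [mul_inv_cancel₀ (X_add_C_ne_zero (b s)), HahnSeries.order_one] at h2
      change 0 = HahnSeries.order (x s) + HahnSeries.order (x s)⁻¹ at h2
      omega
    exact HahnSeries.coeff_eq_zero_of_lt_order (by omega)
  have hx0 : (x s₀)⁻¹ = HahnSeries.single (-1 : ℤ) (1 : K) := by
    refine inv_eq_of_mul_eq_one_right ?_
    change ((PowerSeries.X + PowerSeries.C (b s₀) : PowerSeries K) : LaurentSeries K) * _ = 1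
    rw [hb0, map_zero, add_zero, PowerSeries.coe_X, HahnSeries.single_mul_single]
    simp
  have hyc : ∀ k < 0, y.coeff k = if k = -1 then (c s₀ : K) else 0 := by
    intro k hk
    have h1 : y = ∑ s ∈ T, c s • (x s)⁻¹ := by simp [y, zsmul_eq_mul]
    rw [h1, HahnSeries.coeff_sum, Finset.sum_eq_single_of_mem s₀ hs₀]
    · rw [HahnSeries.coeff_smul, hx0, HahnSeries.coeff_single]
      split_ifs <;> simp
    · intro s _ hs
      rw [HahnSeries.coeff_smul, hy1 s hs k hk, smul_zero]
  rw [← CharP.intCast_eq_zero_iff K p]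
  by_contra hc
  have hp : 2 ≤ p := (Fact.out : p.Prime).two_le
  by_cases hord : 0 ≤ g.order
  · have h1 := hyc (-1) (by norm_num)
    rw [if_pos rfl] at h1
    refine hc (h1.symm.trans ?_)
    rw [hg, HahnSeries.coeff_sub, HahnSeries.coeff_eq_zero_of_lt_order,
      HahnSeries.coeff_eq_zero_of_lt_order, sub_zero]
    · omega
    · rw [HahnSeries.order_pow]
      exact lt_of_lt_of_le (by norm_num) (nsmul_nonneg hord p)
  · -- the pole of `g ^ p` has order at least two and cancels against neither `g` nor `y`
    have hg0 : g ≠ 0 := by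
      rintro rfl
      simp at hord
    have hlt : (p : ℤ) * g.order ≤ 2 * g.order :=
      mul_le_mul_of_nonpos_right (by exact_mod_cast hp) (by omega)
    have h1 : (g ^ p).order = p * g.order := by rw [HahnSeries.order_pow, nsmul_eq_mul]
    have h2 := hyc ((g ^ p).order) (by omega)
    rw [if_neg (by omega), hg, HahnSeries.coeff_sub,
      HahnSeries.coeff_eq_zero_of_lt_order (x := g) (by omega), sub_zero,
      HahnSeries.coeff_order_eq_zero] at h2
    exact pow_ne_zero p hg0 h2

end Places

/-! ### Linearly disjoint extensions -/

section LinearlyDisjoint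

open IntermediateField algebraAdjoinAdjoin

/-- Algebraically independent elements of one of two linearly disjoint extensions remain
algebraically independent over the other one: their monomials remain linearly independent. -/
theorem IntermediateField.LinearDisjoint.algebraicIndependent_left {k Ω : Type*} [Field k] [Field Ω]
    [Algebra k Ω] {A M : IntermediateField k Ω} (H : A.LinearDisjoint M) {ι : Type*} {x : ι → A}
    (hx : AlgebraicIndependent k x) : AlgebraicIndependent M (fun i => (x i : Ω)) := by
  have h1 : LinearIndependent k
      ((MvPolynomial.aeval (R := k) x).toLinearMap ∘ MvPolynomial.basisMonomials ι k) :=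
    (MvPolynomial.basisMonomials ι k).linearIndependent.map' _ (LinearMap.ker_eq_bot.2 hx)
  have h2 := (MvPolynomial.basisMonomials ι M).injective_constr_of_linearIndependent (R₂ := M)
    (H.linearIndependent_left h1)
  have h3 : (MvPolynomial.basisMonomials ι M).constr M (A.val ∘
      ((MvPolynomial.aeval (R := k) x).toLinearMap ∘ MvPolynomial.basisMonomials ι k)) =
      (MvPolynomial.aeval (R := M) fun i => (x i : Ω)).toLinearMap := by
    refine (MvPolynomial.basisMonomials ι M).ext fun m => ?_
    rw [Module.Basis.constr_basis]
    simp [MvPolynomial.aeval_monomial, Finsupp.prod]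
  rw [h3] at h2
  exact h2

theorem transcendental_of_notMem_range {k K : Type*} [Field k] [Field K] [Algebra k K]
    [IsAlgClosed k] {t : K} (ht : t ∉ (algebraMap k K).range) : Transcendental k t := by
  intro h
  refine ht ?_
  exact h.isIntegral.mem_range_algebraMap_of_minpoly_splits (IsAlgClosed.splits _)

/-- Let `t ∈ A` be transcendental over `k`, complete it to a transcendence basis of `A` over `k`,
and let `T` be the set of the other members. The fields `D = k(T)` and `B = M(T)` have the following
properties: `A` is algebraic over `D(t)`, while `t` remains transcendental over `B`. -/
theorem exists_transcendental_tower {k Ω : Type*} [Field k] [Field Ω] [Algebra k Ω] [IsAlgClosed k]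
    {A M : IntermediateField k Ω} (H : A.LinearDisjoint M) {t : Ω} (htA : t ∈ A)
    (ht : t ∉ (algebraMap k Ω).range) :
    ∃ D B : Subfield Ω, D ≤ B ∧ D ≤ A.toSubfield ∧ M.toSubfield ≤ B ∧ Transcendental B t ∧
      ∀ x ∈ A, IsAlgebraic (IntermediateField.adjoin D {t}) x := by
  have htr : Transcendental k (⟨t, htA⟩ : A) := by
    refine transcendental_of_notMem_range ?_
    rintro ⟨c, hc⟩
    exact ht ⟨c, congrArg Subtype.val hc⟩
  obtain ⟨s, hts, hs⟩ := exists_isTranscendenceBasis_superset (R := k) (A := A) (s := {⟨t, htA⟩})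
    (by
      have := algebraicIndependent_unique_type_iff (R := k) (ι := ({⟨t, htA⟩} : Set A))
        (x := fun i => (i : A))
      exact this.2 htr)
  have hts' : (⟨t, htA⟩ : A) ∈ s := hts rfl
  let s' : Set A := s \ {⟨t, htA⟩}
  let T : Set Ω := A.val '' s'
  let D : Subfield Ω := (adjoin k T).toSubfield
  let B : Subfield Ω := (adjoin M T).toSubfield
  refine ⟨D, B, ?_, ?_, ?_, ?_, ?_⟩
  · intro x hx
    have h1 : adjoin k T ≤ (adjoin M T).restrictScalars k :=
      adjoin_le_iff.2 (subset_adjoin M T)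
    exact h1 hx
  · intro x hx
    have h1 : adjoin k T ≤ A := adjoin_le_iff.2 (by rintro _ ⟨y, _, rfl⟩; exact y.2)
    exact h1 hx
  · intro x hx
    exact (adjoin M T).algebraMap_mem ⟨x, hx⟩
  · have h1 : AlgebraicIndependent M (fun i : s => ((i : A) : Ω)) :=
      H.algebraicIndependent_left hs.1
    have h2 : AlgebraicIndepOn M (fun i : A => (i : Ω)) (insert ⟨t, htA⟩ s') := by
      have h3 : insert ⟨t, htA⟩ s' = s := by simp [s', hts']
      rw [h3]
      exact h1
    have h4 := ((AlgebraicIndepOn.insert_iff (by simp [s'])).1 h2).2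
    intro h5
    refine h4 ?_
    exact (IsFractionRing.isAlgebraic_iff (Algebra.adjoin M T) (adjoin M T) Ω).2 h5
  · intro x hx
    have h1 := hs.isAlgebraic_field.isAlgebraic ⟨x, hx⟩
    let E : IntermediateField k Ω := (IntermediateField.adjoin D {t}).toSubfield.toIntermediateField
      fun c => (IntermediateField.adjoin D {t}).algebraMap_mem ⟨_, (adjoin k T).algebraMap_mem c⟩
    have hE : adjoin k (Set.range ((↑) : s → A)) ≤ E.comap A.val := by
      rw [adjoin_le_iff]
      rintro _ ⟨y, rfl⟩
      change (y : Ω) ∈ IntermediateField.adjoin D {t}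
      by_cases hy : (y : A) = ⟨t, htA⟩
      · rw [hy]
        exact mem_adjoin_simple_self D t
      · exact (IntermediateField.adjoin D {t}).algebraMap_mem
          ⟨y, subset_adjoin k T ⟨y, ⟨y.2, hy⟩, rfl⟩⟩
    let f : adjoin k (Set.range ((↑) : s → A)) →+* IntermediateField.adjoin D {t} :=
      (A.val.toRingHom.comp (adjoin k (Set.range ((↑) : s → A))).val.toRingHom).codRestrict
        (IntermediateField.adjoin D {t}).toSubfield fun y => hE y.2
    exact h1.ringHom_of_comp_eq f A.val.toRingHom f.injective (by ext; rfl)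

end LinearlyDisjoint

/-! ### The compositum of two algebraically closed fields -/

section Compositum

variable {Ω : Type u} [Field Ω]

/-- A root in `L` of a polynomial over `L ⊓ M` is algebraic over `M`, so it lies in `M`. -/
theorem Subfield.isAlgClosed_inf (L M : Subfield Ω) [IsAlgClosed L] [IsAlgClosed M] :
    IsAlgClosed ↥(L ⊓ M) := by
  refine IsAlgClosed.of_exists_root _ fun p hp hirr => ?_
  let iL : ↥(L ⊓ M) →+* L := Subfield.inclusion inf_le_left
  let iM : ↥(L ⊓ M) →+* M := Subfield.inclusion inf_le_right
  obtain ⟨x, hx⟩ := IsAlgClosed.exists_eval₂_eq_zero iL p hirr.degree_pos.ne'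
  have h1 : p.eval₂ (L ⊓ M).subtype (x : Ω) = 0 := by
    have h2 := Polynomial.hom_eval₂ p iL L.subtype x
    rw [hx, map_zero] at h2
    exact h2.symm
  have h3 : IsIntegral M (x : Ω) := by
    refine ⟨p.map iM, hp.map _, ?_⟩
    rw [Polynomial.eval₂_map]
    exact h1
  obtain ⟨y, hy⟩ : (x : Ω) ∈ (algebraMap M Ω).range := by
    by_contra h4
    exact transcendental_of_notMem_range h4 h3.isAlgebraic
  have hxM : (x : Ω) ∈ M := hy ▸ y.2
  refine ⟨⟨x, x.2, hxM⟩, ?_⟩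
  apply (L ⊓ M).subtype.injective
  rw [map_zero, ← h1, Polynomial.eval₂_eq_eval_map, ← Polynomial.eval_map_apply]
  rfl

theorem HasUniformizingEmbeddings.comp_injective {N : Type u} [Field N] {S S' : Type*} {q : ℕ}
    {a : S → N} (h : HasUniformizingEmbeddings q a) {f : S' → S} (hf : Function.Injective f) :
    HasUniformizingEmbeddings q (a ∘ f) := by
  intro s₀
  obtain ⟨K, W, _, _, j, J, b, hb0, hb, hJ, hpow⟩ := h (f s₀)
  exact ⟨K, W, _, _, j, J, b ∘ f, hb0, fun s hs => hb _ (hf.ne hs), fun s => hJ _, hpow⟩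

/-- The uniformizers are the elements `t + m`, where `t ∈ L` does not lie in `M` and `m` runs
through the elements of `M` that do not lie in `L`. By linear disjointness such `m` are transcendental over
`L`, hence over the field `D` of the tower attached to `t`. -/
theorem exists_hasUniformizingEmbeddings_add (q : ℕ) [ExpChar Ω q] (L M : Subfield Ω)
    [IsAlgClosed L] [IsAlgClosed M] (hLM : ¬ L ≤ M)
    (hdisj : (Subfield.extendScalars (inf_le_left : L ⊓ M ≤ L)).LinearDisjoint
      (Subfield.extendScalars (inf_le_right : L ⊓ M ≤ M))) :
    ∃ a : {m : M // (m : Ω) ∉ L} → ↥(L ⊔ M), (∀ m, a m ≠ 0) ∧ HasUniformizingEmbeddings q a := by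
  have := Subfield.isAlgClosed_inf L M
  obtain ⟨t, htL, htM⟩ := SetLike.not_le_iff_exists.1 hLM
  obtain ⟨D, B, hDB, hDL, hMB, ht, hL⟩ := exists_transcendental_tower hdisj (t := t) htL
    (by rintro ⟨c, rfl⟩; exact htM c.2.2)
  have hmem : ∀ m : M, t + m ∈ L ⊔ M := fun m =>
    add_mem ((le_sup_left : L ≤ L ⊔ M) htL) ((le_sup_right : M ≤ L ⊔ M) m.2)
  refine ⟨fun m => ⟨t + m.1, hmem m⟩, fun m h => ?_, fun m₀ => ?_⟩
  · have h1 : t + m.1 = 0 := congrArg Subtype.val h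
    rw [eq_neg_of_add_eq_zero_left h1] at htM
    exact htM (neg_mem m.1.2)
  · have hm : Transcendental D ((⟨m₀.1, hMB m₀.1.2⟩ : B) : Ω) := by
      let x : Unit → Subfield.extendScalars (inf_le_right : L ⊓ M ≤ M) := fun _ => ⟨m₀.1, m₀.1.2⟩
      have h1 : AlgebraicIndependent ↥(L ⊓ M) x := by
        refine algebraicIndependent_unique_type_iff.2 (transcendental_of_notMem_range ?_)
        rintro ⟨c, hc⟩
        refine m₀.2 ?_
        rw [← show (c : Ω) = m₀.1 from congrArg Subtype.val hc]
        exact c.2.1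
      have h2 := algebraicIndependent_unique_type_iff.1 (hdisj.symm.algebraicIndependent_left h1)
      exact h2.of_ringHom_of_comp_eq (R := D) (S := Subfield.extendScalars
        (inf_le_left : L ⊓ M ≤ L)) (Subfield.inclusion hDL) (RingHom.id Ω)
        (Subfield.inclusion hDL).injective rfl
    obtain ⟨K, W, _, _, i, j, J, hJ, hpow⟩ := exists_laurentSeries_embedding q hDB ht hm hL
      (N := L ⊔ M) (sup_le_sup_left hMB L)
    refine ⟨K, W, inferInstance, inferInstance, j, J,
      fun m => i ⟨m.1, hMB m.1.2⟩ - i ⟨m₀.1, hMB m₀.1.2⟩, sub_self _, fun m hmm h => ?_, fun m =>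
      hJ _ ⟨m.1, hMB m.1.2⟩ rfl, hpow⟩
    have h1 := i.injective (sub_eq_zero.1 h)
    exact hmm (Subtype.ext (Subtype.ext (congrArg (Subtype.val : B → Ω) h1)))

open Cardinal in
theorem Subfield.mk_sup_le (L M : Subfield Ω) [Infinite M] : #↥(L ⊔ M) ≤ max #L #M := by
  have h1 : L ⊔ M = Subfield.closure ((L : Set Ω) ∪ M) := by
    rw [Subfield.closure_union, Subfield.closure_eq, Subfield.closure_eq]
  rw [h1]
  refine (Subfield.cardinalMk_closure_le_max _).trans ?_
  have h2 : ℵ₀ ≤ max #L #M := (Cardinal.aleph0_le_mk M).trans (le_max_right _ _)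
  refine max_le ((mk_union_le _ _).trans ?_) h2
  exact Cardinal.add_le_of_le h2 (le_max_left _ _) (le_max_right _ _)

open Cardinal in
/-- If `C` is an infinite proper subgroup of `M`, then its complement contains a coset of `C`. -/
theorem Subfield.mk_le_mk_notMem (L M : Subfield Ω) [Infinite ↥(L ⊓ M)] (hML : ¬ M ≤ L) :
    #M ≤ #{m : M // (m : Ω) ∉ L} := by
  obtain ⟨m₀, hm₀, hm₀L⟩ := SetLike.not_le_iff_exists.1 hML
  let f : ↥(L ⊓ M) → {m : M // (m : Ω) ∉ L} := fun c =>
    ⟨⟨m₀ + c, add_mem hm₀ c.2.2⟩, fun h => hm₀L ((add_mem_cancel_right c.2.1).1 h)⟩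
  have hf : Function.Injective f := fun c d h => by
    have h1 : m₀ + (c : Ω) = m₀ + d := congrArg (fun x => (x.1 : Ω)) h
    exact Subtype.ext (add_left_cancel h1)
  have : Infinite {m : M // (m : Ω) ∉ L} := Infinite.of_injective f hf
  have h2 : #{m : M // (m : Ω) ∈ L} ≤ #↥(L ⊓ M) :=
    mk_le_of_injective (f := fun m => ⟨m.1, m.2, m.1.2⟩) fun a b h =>
      Subtype.ext (Subtype.ext (congrArg (Subtype.val : ↥(L ⊓ M) → Ω) h))
  rw [← mk_sum_compl {m : M | (m : Ω) ∈ L}]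
  refine add_le_of_le (aleph0_le_mk _) (h2.trans (mk_le_of_injective hf)) le_rfl

/-- The compositum of `L` and `M` contains a family with uniformizing embeddings of the greatest
possible size. -/
theorem exists_hasUniformizingEmbeddings_sup (q : ℕ) [ExpChar Ω q] (L M : Subfield Ω)
    [IsAlgClosed L] [IsAlgClosed M] (hLM : ¬ L ≤ M) (hML : ¬ M ≤ L)
    (hdisj : (Subfield.extendScalars (inf_le_left : L ⊓ M ≤ L)).LinearDisjoint
      (Subfield.extendScalars (inf_le_right : L ⊓ M ≤ M))) :
    ∃ a : ↥(L ⊔ M) → ↥(L ⊔ M), (∀ x, a x ≠ 0) ∧ HasUniformizingEmbeddings q a := by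
  -- the hypotheses are symmetric in `L` and `M`, so that `M` may be assumed to be the larger field
  have aux : ∀ (L M : Subfield Ω) [IsAlgClosed L] [IsAlgClosed M] (hLM : ¬ L ≤ M) (hML : ¬ M ≤ L)
      (hdisj : (Subfield.extendScalars (inf_le_left : L ⊓ M ≤ L)).LinearDisjoint
        (Subfield.extendScalars (inf_le_right : L ⊓ M ≤ M))) (h : Cardinal.mk L ≤ Cardinal.mk M)
      (N : Subfield Ω) (hN : N = L ⊔ M),
      ∃ a : N → N, (∀ x, a x ≠ 0) ∧ HasUniformizingEmbeddings q a := by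
    rintro L M _ _ hLM hML hdisj h _ rfl
    have := Subfield.isAlgClosed_inf L M
    have : Infinite ↥(L ⊓ M) := IsAlgClosed.instInfinite
    have : Infinite M := IsAlgClosed.instInfinite
    obtain ⟨a, ha, ha'⟩ := exists_hasUniformizingEmbeddings_add q L M hLM hdisj
    have h1 : Cardinal.mk ↥(L ⊔ M) ≤ Cardinal.mk {m : M // (m : Ω) ∉ L} :=
      (Subfield.mk_sup_le L M).trans ((max_le h le_rfl).trans (Subfield.mk_le_mk_notMem L M hML))
    obtain ⟨f⟩ := h1
    exact ⟨a ∘ f, fun x => ha _, ha'.comp_injective f.injective⟩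
  rcases le_total (Cardinal.mk L) (Cardinal.mk M) with h | h
  · exact aux L M hLM hML hdisj h _ rfl
  · refine aux M L hML hLM ?_ h _ (sup_comm L M)
    have h1 : ∀ (C : Subfield Ω) (hC : C = L ⊓ M) (hL : C ≤ L) (hM : C ≤ M),
        (Subfield.extendScalars hM).LinearDisjoint (Subfield.extendScalars hL) := by
      rintro _ rfl _ _
      exact hdisj.symm
    exact h1 _ (inf_comm M L) _ _

/-- In characteristic `p`, the image of Frobenius contains `L` and `M`, hence their compositum. -/
theorem Subfield.perfectField_sup (L M : Subfield Ω) [IsAlgClosed L] [IsAlgClosed M] :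
    PerfectField ↥(L ⊔ M) := by
  obtain ⟨p, hp⟩ := CharP.exists Ω
  rcases CharP.char_is_prime_or_zero Ω p with hprime | rfl
  · have : Fact p.Prime := ⟨hprime⟩
    have : CharP ↥(L ⊔ M) p := (L ⊔ M).subtype.charP (L ⊔ M).subtype.injective p
    have : ExpChar ↥(L ⊔ M) p := ExpChar.prime hprime
    have h1 : ∀ (K : Subfield Ω) [IsAlgClosed K], K ≤ K.map (frobenius Ω p) := fun K _ x hx => by
      obtain ⟨z, hz⟩ := IsAlgClosed.exists_pow_nat_eq (⟨x, hx⟩ : K) hprime.pos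
      exact ⟨z, z.2, congrArg Subtype.val hz⟩
    have h2 : L ⊔ M ≤ (L ⊔ M).map (frobenius Ω p) := by
      rw [Subfield.map_sup]
      exact sup_le_sup (h1 L) (h1 M)
    have : PerfectRing ↥(L ⊔ M) p := PerfectRing.ofSurjective _ p fun x => by
      obtain ⟨z, hz, hzx⟩ := h2 x.2
      exact ⟨⟨z, hz⟩, Subtype.ext hzx⟩
    exact PerfectRing.toPerfectField _ p
  · have : CharZero Ω := CharP.charP_to_charZero Ω
    have : CharZero ↥(L ⊔ M) := inferInstance
    infer_instance

end Compositum

/-! ### The Galois group -/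

section Conclusion

open Cardinal

/-- In a torsion group, divisibility of the primary components implies divisibility. -/
theorem exists_nsmul_eq_of_primary {A : Type*} [AddCommGroup A]
    (tA : ∀ a : A, ∃ n : ℕ, 0 < n ∧ n • a = 0)
    (h : ∀ ℓ : ℕ, ℓ.Prime → ∀ (k : ℕ) (a : A), ℓ ^ k • a = 0 → ∃ b, ℓ • b = a) (n : ℕ)
    (hn : 0 < n) (a : A) : ∃ b, n • b = a := by
  have hprime : ∀ ℓ : ℕ, ℓ.Prime → ∀ a : A, ∃ b, ℓ • b = a := fun ℓ hℓ a => by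
    obtain ⟨n, hn, ha⟩ := tA a
    obtain ⟨k, m, hm, rfl⟩ := Nat.exists_eq_pow_mul_and_not_dvd hn.ne' ℓ hℓ.ne_one
    -- with `u * ℓ + v * m = 1`, write `a = ℓ • u • a + v • m • a`
    obtain ⟨b, hb⟩ := h ℓ hℓ k (m • a) (by rwa [← mul_nsmul'])
    obtain ⟨u, v, huv⟩ := Nat.isCoprime_iff_coprime.2 ((hℓ.coprime_iff_not_dvd).2 hm)
    refine ⟨u • a + v • b, ?_⟩
    have h1 : (ℓ : ℤ) • b = (m : ℤ) • a := by simpa using hb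
    rw [← natCast_zsmul, smul_add, smul_smul, smul_comm, h1, smul_smul, ← add_smul, mul_comm, huv,
      one_smul]
  induction n using induction_on_primes generalizing a with
  | zero => exact absurd hn (lt_irrefl 0)
  | one => exact ⟨a, one_nsmul a⟩
  | prime_mul p n hp ih =>
    obtain ⟨b, hb⟩ := hprime p hp a
    obtain ⟨c, hc⟩ := ih (Nat.pos_of_mul_pos_left hn) b
    exact ⟨c, by rw [mul_comm, mul_nsmul, hc, hb]⟩

/-- The character group of the absolute Galois group of `N` is a direct sum of `#N` copies of `ℚ/ℤ`
if `N` is perfect, has all roots of unity and contains `#N` elements with uniformizing embeddings: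
the primary components are governed by Kummer theory away from the characteristic and by
Artin–Schreier theory at the characteristic. -/
theorem nonempty_characterGroup_addEquiv {N : Type u} [Field N] [PerfectField N] [Infinite N]
    (q : ℕ) [ExpChar N q] (hroots : ∀ n : ℕ, (n : N) ≠ 0 → ∃ ζ : N, IsPrimitiveRoot ζ n)
    {a : N → N} (ha0 : ∀ x, a x ≠ 0) (ha : HasUniformizingEmbeddings q a) :
    Nonempty (characterGroup Gal(AlgebraicClosure N/N) ≃+ (N →₀ RatModInt)) := by
  have hcard : #(AlgebraicClosure N) ≤ #N :=
    (Algebra.IsAlgebraic.cardinalMk_le_max N _).trans (max_le le_rfl (aleph0_le_mk N))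
  have tA : ∀ χ : characterGroup Gal(AlgebraicClosure N/N), ∃ n : ℕ, 0 < n ∧ n • χ = 0 :=
    fun χ => characterGroup.exists_nsmul_eq_zero χ
  refine nonempty_addEquiv_finsupp tA (exists_nsmul_eq_of_primary tA ?_) ?_ ?_
  · intro ℓ hℓ k χ hχ
    have : NeZero ℓ := ⟨hℓ.ne_zero⟩
    by_cases h : (ℓ : N) = 0
    · have : Fact ℓ.Prime := ⟨hℓ⟩
      have : CharP N ℓ := (CharP.charP_iff_prime_eq_zero hℓ).2 h
      have : CharP (AlgebraicClosure N) ℓ := inferInstance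
      exact exists_nsmul_eq_of_charP χ hχ
    · obtain ⟨ζ, hζ⟩ := hroots (ℓ ^ k * ℓ) (by
        rw [← pow_succ, Nat.cast_pow]
        exact pow_ne_zero _ h)
      have : NeZero (ℓ ^ k) := ⟨pow_ne_zero k hℓ.ne_zero⟩
      exact exists_nsmul_eq_of_isPrimitiveRoot hζ χ hχ
  · intro ℓ hℓ
    have : NeZero ℓ := ⟨hℓ.ne_zero⟩
    refine le_trans ?_ hcard
    by_cases h : (ℓ : N) = 0
    · have : Fact ℓ.Prime := ⟨hℓ⟩
      have : CharP N ℓ := (CharP.charP_iff_prime_eq_zero hℓ).2 h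
      have : CharP (AlgebraicClosure N) ℓ := inferInstance
      exact mk_torsionBy_characterGroup_le_of_charP
    · obtain ⟨ζ, hζ⟩ := hroots ℓ h
      exact mk_torsionBy_characterGroup_le hζ
  · intro ℓ hℓ
    by_cases h : (ℓ : N) = 0
    · have : Fact ℓ.Prime := ⟨hℓ⟩
      have : CharP N ℓ := (CharP.charP_iff_prime_eq_zero hℓ).2 h
      have : CharP (AlgebraicClosure N) ℓ := inferInstance
      obtain rfl : q = ℓ := ExpChar.eq ‹_› (ExpChar.prime hℓ)
      exact exists_isIndepMod_artinSchreier (fun x => (a x)⁻¹) ha.dvd_of_sum_eq_sub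
    · obtain ⟨ζ, hζ⟩ := hroots ℓ h
      have hco : ℓ.Coprime q := by
        rcases ‹ExpChar N q› with _ | hq
        · exact Nat.coprime_one_right ℓ
        · refine (Nat.coprime_primes hℓ hq).2 ?_
          rintro rfl
          exact h (CharP.cast_eq_zero N ℓ)
      exact exists_isIndepMod_kummer hℓ hζ a ha0 (ha.dvd_of_prod_eq_pow hℓ.ne_zero hco)

theorem subsingleton_maximalAbelianGaloisGroup (F : Type*) [Field F] [PerfectField F]
    [IsSepClosed F] : Subsingleton (maximalAbelianGaloisGroup F) := by
  refine ⟨fun σ τ => AlgEquiv.ext fun x => ?_⟩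
  obtain ⟨c, rfl⟩ := IsSepClosed.algebraMap_surjective F (maximalAbelianExtension F) x
  rw [AlgEquiv.commutes, AlgEquiv.commutes]

theorem Subfield.exists_isPrimitiveRoot_sup {Ω : Type*} [Field Ω] (L M : Subfield Ω)
    [IsAlgClosed L] (n : ℕ) (hn : (n : ↥(L ⊔ M)) ≠ 0) : ∃ ζ : ↥(L ⊔ M), IsPrimitiveRoot ζ n := by
  let i : L →+* ↥(L ⊔ M) := Subfield.inclusion le_sup_left
  have : NeZero (n : L) := ⟨fun h => hn (by rw [← map_natCast i, h, map_zero])⟩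
  obtain ⟨ζ, hζ⟩ := HasEnoughRootsOfUnity.exists_primitiveRoot L n
  exact ⟨i ζ, hζ.map_of_injective i.injective⟩

end Conclusion

theorem theorem4p1 {Ω : Type u} [Field Ω] (L M : Subfield Ω)
    [IsAlgClosed L] [IsAlgClosed M] (hLM : ¬ L ≤ M) (hML : ¬ M ≤ L)
    (hdisj : (Subfield.extendScalars (inf_le_left : L ⊓ M ≤ L)).LinearDisjoint
      (Subfield.extendScalars (inf_le_right : L ⊓ M ≤ M))) :
    (∃ ι : ↥(L ⊔ M) → maximalAbelianGaloisGroup ↥(L ⊔ M), IsFreeProAbelianOn.{w} ι) ∧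
      Nonempty (maximalAbelianGaloisGroup ↥(L ⊔ M) ≃ₜ*
        Multiplicative (↥(L ⊔ M) → ProfiniteInt)) ∧
      ¬ IsSepClosed ↥(L ⊔ M) := by
  have := Subfield.perfectField_sup L M
  have : Infinite L := IsAlgClosed.instInfinite
  have : Infinite ↥(L ⊔ M) := Infinite.of_injective
    (Subfield.inclusion (le_sup_left : L ≤ L ⊔ M)) (RingHom.injective _)
  obtain ⟨q, hq⟩ := ExpChar.exists Ω
  have : ExpChar ↥(L ⊔ M) q := (L ⊔ M).subtype.expChar (L ⊔ M).subtype.injective q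
  obtain ⟨a, ha0, ha⟩ := exists_hasUniformizingEmbeddings_sup q L M hLM hML hdisj
  obtain ⟨e₁⟩ := nonempty_characterGroup_addEquiv q (Subfield.exists_isPrimitiveRoot_sup L M)
    ha0 ha
  obtain ⟨e₂⟩ := nonempty_characterGroup_maximalAbelian ↥(L ⊔ M)
  have hG := isProAbelian_maximalAbelianGaloisGroup ↥(L ⊔ M)
  obtain ⟨e⟩ := nonempty_continuousMulEquiv_profiniteInt hG (e₂.trans e₁)
  refine ⟨⟨_, isFreeProAbelianOn_profiniteBasis.of_continuousMulEquiv hG e.symm⟩, ⟨e⟩, fun h => ?_⟩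
  have := subsingleton_maximalAbelianGaloisGroup ↥(L ⊔ M)
  -- a separably closed field has trivial Galois group, but basis vectors of `Ẑ^N` are nontrivial
  have h1 := profiniteBasis_apply_self (0 : ↥(L ⊔ M)) 2
  rw [e.symm.injective (Subsingleton.elim (e.symm (profiniteBasis 0)) (e.symm 1))] at h1
  exact zero_ne_one (α := ZMod 2) h1
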